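/- The integer complexity $f(n)$ of a positive integer $n$ is the minimum number of $1$'s in an arithmetic expression of value $n$ built from $1$'s using additions, multiplications and parentheses. Theorem. There is a deterministic algorithm that, given a positive integer $N$, computes $f(n)$ for all $1\le n\le N$ in $O(N\,\mathrm{polylog}\,N)$ time on a word RAM with words of $\Theta(\log N)$ bits. Precisely, there are one word RAM program and constants $c\ge 1$, $C$ and $k$ such that for every integer $N\ge 1$ and every word length $w\ge c\cdot(\lfloor\log_2 N\rfloor+1)$, the program, run on input $N$ with all other memory initially zero, halts after at most $C\,N\,(\lfloor\log_2 N\rfloor+1)^k$ steps with $f(n)$ stored in cell $n$ of its output array for every $1\le n\le N$. Here one step is one elementary operation on $w$-bit words: reading a constant or a register, reading or writing a memory cell, addition, truncated subtraction, multiplication, division with remainder, comparison (results reduced modulo $2^w$), or a control operation. -/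

import Mathlib

/-- Arithmetic expressions built from the number `1` by additions and multiplications
(the tree structure plays the role of the parentheses). -/
inductive OnesExpr : Type where
  | one : OnesExpr
  | add : OnesExpr → OnesExpr → OnesExpr
  | mul : OnesExpr → OnesExpr → OnesExpr

namespace OnesExpr

/-- The value of an expression. -/
def value : OnesExpr → ℕ
  | one => 1
  | add a b => value a + value b
  | mul a b => value a * value b

/-- The number of `1`'s occurring in an expression. -/
def ones : OnesExpr → ℕ
  | one => 1
  | add a b => ones a + ones b
  | mul a b => ones a + ones b

end OnesExpr

/-- Every positive integer is represented by some expression, so that the minimum in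
`integerComplexity` below is taken over a nonempty set. -/
theorem exists_onesExpr_value (n : ℕ) (hn : 1 ≤ n) : ∃ e : OnesExpr, e.value = n := by
  induction n, hn using Nat.le_induction with
  | base => exact ⟨.one, rfl⟩
  | succ n _ ih =>
    obtain ⟨e, he⟩ := ih
    exact ⟨.add e .one, by simp [OnesExpr.value, he]⟩

/-- The integer complexity of a positive integer `n`: the least number of `1`'s in an expression
of value `n`. (For `n = 0` there is no such expression, and the value is the default `0`.) -/
noncomputable def integerComplexity (n : ℕ) : ℕ :=
  sInf {k : ℕ | ∃ e : OnesExpr, e.value = n ∧ e.ones = k}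

/-! A deterministic word RAM with `w`-bit words, programmed by structured (while) programs.

A machine has registers and random access arrays, both named by natural numbers that are
written literally in the program; a program, being a finite text, uses only finitely many of them.
Registers and array cells hold words, i.e. natural numbers below `2 ^ w`, and array cells are
addressed by words. Every elementary operation on words costs one step. -/

namespace WordRAM

/-- The elementary operations on words. -/
inductive Op : Type where
  | add | sub | mul | div | mod | lt | eq

/-- The elementary operations on natural numbers before reduction to `w` bits. Subtraction is
truncated at zero, division rounds down (`a / 0 = 0` and `a % 0 = a`), comparisons return
`1` for true and `0` for false. -/
def Op.apply : Op → ℕ → ℕ → ℕ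
  | .add, a, b => a + b
  | .sub, a, b => a - b
  | .mul, a, b => a * b
  | .div, a, b => a / b
  | .mod, a, b => a % b
  | .lt, a, b => if a < b then 1 else 0
  | .eq, a, b => if a = b then 1 else 0

/-- The contents of the memory: `reg r` is the word in register `r`, and `arr a i` is the word in
cell `i` of array `a`. -/
structure State : Type where
  reg : ℕ → ℕ
  arr : ℕ → ℕ → ℕ

/-- Expressions: constants, registers, array cells `a[e]`, and elementary operations. -/
inductive Expr : Type where
  | const : ℕ → Expr
  | reg : ℕ → Expr
  | load : ℕ → Expr → Expr
  | op : Op → Expr → Expr → Expr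

/-- Evaluation of an expression on a machine with `w`-bit words: all results are reduced modulo
`2 ^ w`. -/
def Expr.eval (w : ℕ) (s : State) : Expr → ℕ
  | .const n => n % 2 ^ w
  | .reg r => s.reg r
  | .load a e => s.arr a (e.eval w s)
  | .op o e₁ e₂ => o.apply (e₁.eval w s) (e₂.eval w s) % 2 ^ w

/-- The number of steps taken by the evaluation of an expression: one for each constant, register
access, array access and elementary operation. -/
def Expr.cost : Expr → ℕ
  | .const _ => 1
  | .reg _ => 1
  | .load _ e => e.cost + 1
  | .op _ e₁ e₂ => e₁.cost + e₂.cost + 1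

/-- Programs. -/
inductive Program : Type where
  /-- do nothing -/
  | skip : Program
  /-- write the value of an expression into a register -/
  | assign : ℕ → Expr → Program
  /-- `store a i e` writes the value of `e` into the cell of array `a` with address the
  value of `i` -/
  | store : ℕ → Expr → Expr → Program
  /-- sequential composition -/
  | seq : Program → Program → Program
  /-- `branch e p q` executes `p` if `e` is nonzero and `q` otherwise -/
  | branch : Expr → Program → Program → Program
  /-- `loop e p` executes `p` as long as `e` is nonzero -/
  | loop : Expr → Program → Program

/-- The state after writing `v` into register `r`. -/
def State.setReg (s : State) (r v : ℕ) : State :=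
  { s with reg := Function.update s.reg r v }

/-- The state after writing `v` into cell `i` of array `a`. -/
def State.setArr (s : State) (a i v : ℕ) : State :=
  { s with arr := Function.update s.arr a (Function.update (s.arr a) i v) }

/-- `Exec w p s s' t`: on a machine with `w`-bit words, the program `p` started in state `s` halts
in state `s'` after exactly `t` steps. -/
inductive Exec (w : ℕ) : Program → State → State → ℕ → Prop where
  | skip (s : State) : Exec w .skip s s 1
  | assign (s : State) (r : ℕ) (e : Expr) :
      Exec w (.assign r e) s (s.setReg r (e.eval w s)) (e.cost + 1)
  | store (s : State) (a : ℕ) (i e : Expr) :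
      Exec w (.store a i e) s (s.setArr a (i.eval w s) (e.eval w s)) (i.cost + e.cost + 1)
  | seq {s₁ s₂ s₃ : State} {p q : Program} {t₁ t₂ : ℕ} :
      Exec w p s₁ s₂ t₁ → Exec w q s₂ s₃ t₂ → Exec w (.seq p q) s₁ s₃ (t₁ + t₂)
  | branch_true {s s' : State} {e : Expr} {p q : Program} {t : ℕ} :
      e.eval w s ≠ 0 → Exec w p s s' t → Exec w (.branch e p q) s s' (e.cost + 1 + t)
  | branch_false {s s' : State} {e : Expr} {p q : Program} {t : ℕ} :
      e.eval w s = 0 → Exec w q s s' t → Exec w (.branch e p q) s s' (e.cost + 1 + t)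
  | loop_true {s₁ s₂ s₃ : State} {e : Expr} {p : Program} {t₁ t₂ : ℕ} :
      e.eval w s₁ ≠ 0 → Exec w p s₁ s₂ t₁ → Exec w (.loop e p) s₂ s₃ t₂ →
      Exec w (.loop e p) s₁ s₃ (e.cost + 1 + t₁ + t₂)
  | loop_false {s : State} {e : Expr} {p : Program} :
      e.eval w s = 0 → Exec w (.loop e p) s s (e.cost + 1)

/-- The initial state on input `N`: register `0` holds `N`, and all other registers and all array
cells hold `0`. -/
def initState (N : ℕ) : State where
  reg := fun r => if r = 0 then N else 0
  arr := fun _ _ => 0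

end WordRAM

/-! ### Integer complexity -/

namespace OnesExpr

/-! Write f for the integer complexity. An optimal expression of n > 1 is a sum or a product of
optimal expressions of some a and b with f(a) + f(b) = f(n) (`exists_integerComplexity_add_eq`).
Once all values below k are in a table, the arguments of complexity k are the new sums and products
of pairs whose complexities add up to k. Binary expansion gives f(n) ≤ 3 log₂ n + 1, so only O(log
N) values of k matter.

Products are cheap: the number of pairs with ab ≤ N is the harmonic sum of N / a, which is O(N log
N) (`sum_div_le`). For sums, the set {f = i} + {f = k - i} is the support of a product of two
polynomials with coefficients 0 and 1. One fast convolution for each pair i < k, hence O(log² N)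
convolutions in all, finds every sum.

The convolution is deterministic and uses only word arithmetic modulo M = 2N + 1, with no search for
primes or roots of unity. It is a negacyclic product modulo X^n + 1, with n = 2^e > 2N, computed by
Nussbaumer's recursion. A block of length mr is written as Σ X^i a_i(y), where y = X^m satisfies y^r
= -1. Powers of y then serve as roots of unity, and multiplying by them is a signed shift. A Fourier
transform of length 2m therefore reduces the product of two blocks to 2m products of blocks of
length r ≈ m (`fourier_step`, `sum_fourier_mul`). All blocks are processed level by level. The data
double at each level, but there are only about log e levels, which costs a factor O(e).

The factors 2m produced by transforming back are never divided out, so the result carries an unknown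
factor 2^κ. Since M is odd, this does not change which coefficients vanish. The true coefficients
are at most N + 1 < M, so they vanish modulo M only if they are zero (`mod_pos_iff`).

For correctness, blocks are tracked only through their values in one commutative ring S where M = 0
and X^n = -1; every level is evaluated at a power of X. At the end S is (ℤ/M)[X]/(X^n + 1), where a
polynomial of degree below n is determined by its class. Overflow is excluded uniformly: memory
words stay below a bound V with V^10 < 2^w, and every expression evaluated without reduction has
degree at most 10 in V. -/

theorem one_le_value (e : OnesExpr) : 1 ≤ e.value := by
  induction e with
  | one => exact le_rfl
  | add a b iha ihb => simp only [value]; omega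
  | mul a b iha ihb => exact Nat.mul_pos iha ihb

theorem one_le_ones (e : OnesExpr) : 1 ≤ e.ones := by
  induction e with
  | one => exact le_rfl
  | add a b iha ihb => simp only [ones]; omega
  | mul a b iha ihb => simp only [ones]; omega

end OnesExpr

theorem integerComplexity_le_ones (e : OnesExpr) : integerComplexity e.value ≤ e.ones :=
  Nat.sInf_le ⟨e, rfl, rfl⟩

theorem exists_onesExpr_ones_eq {n : ℕ} (hn : 1 ≤ n) :
    ∃ e : OnesExpr, e.value = n ∧ e.ones = integerComplexity n := by
  obtain ⟨e, he⟩ := exists_onesExpr_value n hn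
  exact Nat.sInf_mem (s := {k : ℕ | ∃ e : OnesExpr, e.value = n ∧ e.ones = k}) ⟨_, e, he, rfl⟩

theorem one_le_integerComplexity {n : ℕ} (hn : 1 ≤ n) : 1 ≤ integerComplexity n := by
  obtain ⟨e, -, he⟩ := exists_onesExpr_ones_eq hn
  exact he ▸ e.one_le_ones

theorem integerComplexity_one : integerComplexity 1 = 1 :=
  le_antisymm (integerComplexity_le_ones .one) (one_le_integerComplexity le_rfl)

theorem integerComplexity_add_le {a b : ℕ} (ha : 1 ≤ a) (hb : 1 ≤ b) :
    integerComplexity (a + b) ≤ integerComplexity a + integerComplexity b := by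
  obtain ⟨e, rfl, he⟩ := exists_onesExpr_ones_eq ha
  obtain ⟨e', rfl, he'⟩ := exists_onesExpr_ones_eq hb
  rw [← he, ← he']
  exact integerComplexity_le_ones (.add e e')

theorem integerComplexity_mul_le {a b : ℕ} (ha : 1 ≤ a) (hb : 1 ≤ b) :
    integerComplexity (a * b) ≤ integerComplexity a + integerComplexity b := by
  obtain ⟨e, rfl, he⟩ := exists_onesExpr_ones_eq ha
  obtain ⟨e', rfl, he'⟩ := exists_onesExpr_ones_eq hb
  rw [← he, ← he']
  exact integerComplexity_le_ones (.mul e e')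

/-- An optimal expression of an integer greater than `1` splits into two optimal expressions. -/
theorem exists_integerComplexity_add_eq {n : ℕ} (hn : 2 ≤ n) :
    ∃ a b : ℕ, 1 ≤ a ∧ 1 ≤ b ∧ (a + b = n ∨ a * b = n) ∧
      integerComplexity a + integerComplexity b = integerComplexity n := by
  obtain ⟨e, he, hones⟩ := exists_onesExpr_ones_eq (n := n) (by omega)
  cases e with
  | one => simp only [OnesExpr.value] at he; omega
  | add a b =>
    refine ⟨a.value, b.value, a.one_le_value, b.one_le_value, Or.inl he, ?_⟩
    have h1 := integerComplexity_add_le a.one_le_value b.one_le_value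
    have h2 := integerComplexity_le_ones a
    have h3 := integerComplexity_le_ones b
    simp only [OnesExpr.value, OnesExpr.ones] at he hones
    rw [he] at h1
    omega
  | mul a b =>
    refine ⟨a.value, b.value, a.one_le_value, b.one_le_value, Or.inr he, ?_⟩
    have h1 := integerComplexity_mul_le a.one_le_value b.one_le_value
    have h2 := integerComplexity_le_ones a
    have h3 := integerComplexity_le_ones b
    simp only [OnesExpr.value, OnesExpr.ones] at he hones
    rw [he] at h1
    omega

/-- Horner's scheme in base two: passing from n / 2 to n costs two ones for the doubling and at most
one for the last digit. -/
theorem integerComplexity_le_of_lt_two_pow (e n : ℕ) (h1 : 1 ≤ n) (hn : n < 2 ^ (e + 1)) :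
    integerComplexity n ≤ 3 * e + 1 := by
  induction e generalizing n with
  | zero =>
    obtain rfl : n = 1 := by omega
    simp [integerComplexity_one]
  | succ e ih =>
    rcases Nat.lt_or_ge n 2 with h | h
    · obtain rfl : n = 1 := by omega
      simp [integerComplexity_one]
    have hq := ih (n / 2) (by omega) (by rw [pow_succ] at hn; omega)
    have htwo : integerComplexity 2 ≤ 2 := integerComplexity_le_ones (.add .one .one)
    have hmul := integerComplexity_mul_le (a := 2) (b := n / 2) (by norm_num) (by omega)
    rcases Nat.mod_two_eq_zero_or_one n with h0 | h0
    · have : 2 * (n / 2) = n := by omega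
      rw [this] at hmul
      omega
    · have hadd := integerComplexity_add_le (a := 2 * (n / 2)) (b := 1) (by omega) le_rfl
      have : 2 * (n / 2) + 1 = n := by omega
      rw [this, integerComplexity_one] at hadd
      omega

/-! ### Running programs on the word RAM -/

namespace WordRAM

instance : Add Expr := ⟨.op .add⟩
instance : Sub Expr := ⟨.op .sub⟩
instance : Mul Expr := ⟨.op .mul⟩
instance : Div Expr := ⟨.op .div⟩
instance : Mod Expr := ⟨.op .mod⟩

/-- Evaluation of an expression without overflow. -/
def Expr.evalNat (s : State) : Expr → ℕ
  | .const n => n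
  | .reg r => s.reg r
  | .load a e => s.arr a (e.evalNat s)
  | .op o e₁ e₂ => o.apply (e₁.evalNat s) (e₂.evalNat s)

section evalNat

variable (s : State) (a b : Expr)

theorem evalNat_const (n : ℕ) : (Expr.const n).evalNat s = n := rfl
theorem evalNat_reg (r : ℕ) : (Expr.reg r).evalNat s = s.reg r := rfl
theorem evalNat_load (r : ℕ) : (Expr.load r a).evalNat s = s.arr r (a.evalNat s) := rfl
theorem evalNat_mul : (a * b).evalNat s = a.evalNat s * b.evalNat s := rfl
theorem evalNat_lt : (Expr.op .lt a b).evalNat s =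
    if a.evalNat s < b.evalNat s then 1 else 0 := rfl

end evalNat

/-- If all words in the memory are at most `V ≥ 4`, then the value of `e` is at most
`V ^ e.degree`. -/
def Expr.degree : Expr → ℕ
  | .const _ => 1
  | .reg _ => 1
  | .load _ _ => 1
  | .op .add a b => max a.degree b.degree + 1
  | .op .sub a _ => a.degree
  | .op .mul a b => a.degree + b.degree
  | .op .div a _ => a.degree
  | .op .mod a _ => a.degree
  | .op .lt _ _ => 0
  | .op .eq _ _ => 0

/-- All constants in the expression are at most `4`, and all subexpressions have degree at most
`d`. -/
def Expr.Small (d : ℕ) : Expr → Bool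
  | .const n => decide (n ≤ 4) && decide (1 ≤ d)
  | .reg _ => decide (1 ≤ d)
  | .load _ e => e.Small d && decide (1 ≤ d)
  | .op o a b => a.Small d && b.Small d && decide ((Expr.op o a b).degree ≤ d)

/-- The expression does not read the array `a`. -/
def Expr.Avoids (a : ℕ) : Expr → Bool
  | .const _ => true
  | .reg _ => true
  | .load b e => decide (b ≠ a) && e.Avoids a
  | .op _ x y => x.Avoids a && y.Avoids a

theorem Expr.eval_congr {w a : ℕ} {s s' : State} (e : Expr) (he : e.Avoids a = true)
    (hr : s.reg = s'.reg) (ha : ∀ b, b ≠ a → s.arr b = s'.arr b) : e.eval w s = e.eval w s' := by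
  induction e with
  | const n => rfl
  | reg r => simp only [eval, hr]
  | load b e ih =>
    simp only [Avoids, Bool.and_eq_true, decide_eq_true_eq] at he
    simp only [eval, ih he.2, ha b he.1]
  | op o x y ihx ihy =>
    simp only [Avoids, Bool.and_eq_true] at he
    simp only [eval, ihx he.1, ihy he.2]

/-- All words in the memory are at most `V`. -/
structure State.Bounded (V : ℕ) (s : State) : Prop where
  reg_le : ∀ r, s.reg r ≤ V
  arr_le : ∀ a i, s.arr a i ≤ V

theorem State.Bounded.setReg {V : ℕ} {s : State} (hs : s.Bounded V) (r : ℕ) {v : ℕ} (hv : v ≤ V) :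
    (s.setReg r v).Bounded V := by
  refine ⟨fun r' => ?_, hs.arr_le⟩
  by_cases h : r' = r
  · simpa [State.setReg, h] using hv
  · simpa [State.setReg, h] using hs.reg_le r'

theorem State.Bounded.setArr {V : ℕ} {s : State} (hs : s.Bounded V) (a i : ℕ) {v : ℕ}
    (hv : v ≤ V) : (s.setArr a i v).Bounded V := by
  refine ⟨hs.reg_le, fun a' i' => ?_⟩
  by_cases h : a' = a
  · subst h
    by_cases h' : i' = i
    · simpa [State.setArr, h'] using hv
    · simpa [State.setArr, h'] using hs.arr_le a' i'
  · simpa [State.setArr, h] using hs.arr_le a' i'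

/-- Words have room for the tenth power of `V`. -/
structure Roomy (w V : ℕ) : Prop where
  four_le : 4 ≤ V
  pow_lt : V ^ 10 < 2 ^ w

theorem Roomy.lt {w V : ℕ} (h : Roomy w V) {v : ℕ} (hv : v ≤ V) : v < 2 ^ w :=
  (hv.trans (Nat.le_self_pow (by norm_num) V)).trans_lt h.pow_lt

/-- Degrees bound values as for polynomials in V. A sum costs one extra degree, because twice a
power of V is at most the next power. Truncated subtraction, quotients and remainders do not exceed
their first operand. -/
theorem Expr.evalNat_le {V : ℕ} (hV : 4 ≤ V) {s : State} (hs : s.Bounded V) {d : ℕ} (e : Expr)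
    (he : e.Small d = true) : e.evalNat s ≤ V ^ e.degree := by
  have h1 : ∀ k, 1 ≤ V ^ k := fun k => Nat.one_le_pow _ _ (by omega)
  induction e with
  | const n =>
    simp only [Small, Bool.and_eq_true, decide_eq_true_eq] at he
    simp only [evalNat, degree, pow_one]
    omega
  | reg r => simpa [evalNat, degree] using hs.reg_le r
  | load b e ih => simpa [evalNat, degree] using hs.arr_le b _
  | op o x y ihx ihy =>
    simp only [Small, Bool.and_eq_true] at he
    have hx := ihx he.1.1
    have hy := ihy he.1.2
    cases o with
    | add =>
      simp only [evalNat, degree, Op.apply, pow_succ]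
      have hx' := hx.trans (Nat.pow_le_pow_right (by omega : 0 < V)
        (le_max_left x.degree y.degree))
      have hy' := hy.trans (Nat.pow_le_pow_right (by omega : 0 < V)
        (le_max_right x.degree y.degree))
      nlinarith [h1 (max x.degree y.degree)]
    | sub => exact (Nat.sub_le _ _).trans hx
    | mul =>
      simp only [evalNat, degree, Op.apply, pow_add]
      exact Nat.mul_le_mul hx hy
    | div => exact (Nat.div_le_self _ _).trans hx
    | mod => exact (Nat.mod_le _ _).trans hx
    | lt =>
      simp only [evalNat, degree, Op.apply, pow_zero]
      split_ifs <;> omega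
    | eq =>
      simp only [evalNat, degree, Op.apply, pow_zero]
      split_ifs <;> omega

/-- Every subexpression stays below V^10 < 2^w, so no reduction takes effect. As `Expr.Small` is a
Boolean function of the expression, its hypothesis can be settled by `decide` for each concrete
program. -/
theorem Expr.eval_eq_evalNat {w V : ℕ} (hV : Roomy w V) {s : State} (hs : s.Bounded V) (e : Expr)
    (he : e.Small 10 = true) : e.eval w s = e.evalNat s := by
  induction e with
  | const n =>
    simp only [Small, Bool.and_eq_true, decide_eq_true_eq] at he
    exact Nat.mod_eq_of_lt (hV.lt (he.1.trans hV.four_le))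
  | reg r => rfl
  | load b e ih =>
    simp only [Small, Bool.and_eq_true] at he
    simp only [eval, evalNat, ih he.1]
  | op o x y ihx ihy =>
    have hle := Expr.evalNat_le hV.four_le hs _ he
    simp only [Small, Bool.and_eq_true, decide_eq_true_eq] at he
    rw [eval, ihx he.1.1, ihy he.1.2]
    refine Nat.mod_eq_of_lt (hle.trans_lt (lt_of_le_of_lt ?_ hV.pow_lt))
    exact Nat.pow_le_pow_right (by have := hV.four_le; omega) he.2

theorem Expr.eval_lt_eq_zero {w V : ℕ} (hV : Roomy w V) {s : State} (hs : s.Bounded V)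
    (a b : Expr) (he : (Expr.op .lt a b).Small 10 = true) :
    (Expr.op .lt a b).eval w s = 0 ↔ b.evalNat s ≤ a.evalNat s := by
  rw [Expr.eval_eq_evalNat hV hs _ he, evalNat_lt]
  split_ifs with h
  · simp [h]
  · simpa using h

/-- The program `P`, started in `s`, halts after at most `b` steps in a state with the
property `Q`. -/
def Runs (w : ℕ) (P : Program) (s : State) (b : ℕ) (Q : State → Prop) : Prop :=
  ∃ s' t, Exec w P s s' t ∧ t ≤ b ∧ Q s'

/-! ### A calculus for upper bounds on running times. -/

section Runs

variable {w : ℕ} {P P' : Program} {s : State} {b b' : ℕ} {Q Q' : State → Prop}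

theorem Runs.mono (h : Runs w P s b Q) (hb : b ≤ b') (hQ : ∀ s₁, Q s₁ → Q' s₁) :
    Runs w P s b' Q' :=
  let ⟨s', t, h1, h2, h3⟩ := h
  ⟨s', t, h1, h2.trans hb, hQ s' h3⟩

theorem Runs.le (h : Runs w P s b Q) (hb : b ≤ b') : Runs w P s b' Q :=
  h.mono hb fun _ h => h

theorem Runs.seq (h : Runs w P s b Q) (h' : ∀ s₁, Q s₁ → Runs w P' s₁ b' Q') :
    Runs w (.seq P P') s (b + b') Q' := by
  obtain ⟨s', t, h1, h2, h3⟩ := h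
  obtain ⟨s'', t', h1', h2', h3'⟩ := h' s' h3
  exact ⟨s'', t + t', .seq h1 h1', by omega, h3'⟩

theorem Runs.assign {r : ℕ} {e : Expr} (hQ : Q (s.setReg r (e.eval w s))) :
    Runs w (.assign r e) s (e.cost + 1) Q :=
  ⟨_, _, .assign s r e, le_rfl, hQ⟩

theorem Runs.store {a : ℕ} {i e : Expr} (hQ : Q (s.setArr a (i.eval w s) (e.eval w s))) :
    Runs w (.store a i e) s (i.cost + e.cost + 1) Q :=
  ⟨_, _, .store s a i e, le_rfl, hQ⟩

theorem Runs.assign_seq {r : ℕ} {e : Expr} (h : Runs w P (s.setReg r (e.eval w s)) b Q) :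
    Runs w (.seq (.assign r e) P) s (e.cost + 1 + b) Q :=
  Runs.seq (Q := fun s' => s' = s.setReg r (e.eval w s)) (.assign rfl) fun _ hs₁ => hs₁ ▸ h

theorem Runs.store_seq {a : ℕ} {i e : Expr}
    (h : Runs w P (s.setArr a (i.eval w s) (e.eval w s)) b Q) :
    Runs w (.seq (.store a i e) P) s (i.cost + e.cost + 1 + b) Q :=
  Runs.seq (Q := fun s' => s' = s.setArr a (i.eval w s) (e.eval w s)) (.store rfl)
    fun _ hs₁ => hs₁ ▸ h

/-- Assignment of an expression whose evaluation does not overflow. -/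
theorem Runs.assignNat_seq {V r : ℕ} {e : Expr} (hV : Roomy w V) (hs : s.Bounded V)
    (he : e.Small 10 = true) (h : Runs w P (s.setReg r (e.evalNat s)) b Q) :
    Runs w (.seq (.assign r e) P) s (e.cost + 1 + b) Q :=
  Runs.assign_seq (by rwa [e.eval_eq_evalNat hV hs he])

theorem Runs.assignNat {V r : ℕ} {e : Expr} (hV : Roomy w V) (hs : s.Bounded V)
    (he : e.Small 10 = true) (hQ : Q (s.setReg r (e.evalNat s))) :
    Runs w (.assign r e) s (e.cost + 1) Q :=
  Runs.assign (by rwa [e.eval_eq_evalNat hV hs he])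

theorem Runs.storeNat {V a : ℕ} {i e : Expr} (hV : Roomy w V) (hs : s.Bounded V)
    (hi : i.Small 10 = true) (he : e.Small 10 = true)
    (hQ : Q (s.setArr a (i.evalNat s) (e.evalNat s))) :
    Runs w (.store a i e) s (i.cost + e.cost + 1) Q :=
  Runs.store (by rwa [e.eval_eq_evalNat hV hs he, i.eval_eq_evalNat hV hs hi])

/-- A loop with invariant `I`, indexed by ghost variables in `ι`, and potential `Φ`. -/
theorem Runs.loop {ι : Type*} {e : Expr} (I : ι → State → Prop) (Φ : ι → ℕ)
    (hbody : ∀ g s, I g s → e.eval w s ≠ 0 → ∃ b, Runs w P s b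
      fun s' => ∃ g', I g' s' ∧ b + e.cost + 1 + Φ g' ≤ Φ g)
    (g : ι) (hg : I g s) :
    Runs w (.loop e P) s (Φ g + e.cost + 1) fun s' => ∃ g', I g' s' ∧ e.eval w s' = 0 := by
  induction hn : Φ g using Nat.strong_induction_on generalizing g s with
  | _ n ih =>
    subst hn
    by_cases h : e.eval w s = 0
    · exact ⟨s, _, .loop_false h, by omega, g, hg, h⟩
    · obtain ⟨b, s', t, h1, h2, g', hg', hΦ⟩ := hbody g s hg h
      obtain ⟨s'', t', h1', h2', h3'⟩ := ih (Φ g') (by omega) g' hg' rfl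
      exact ⟨s'', _, .loop_true h h1 h1', by omega, h3'⟩

end Runs

end WordRAM

namespace WordRAM

/-! ### Registers and arrays used by the program -/

namespace Var

/-- The input. -/
abbrev N : ℕ := 0
/-- The modulus of the convolutions. -/
abbrev M : ℕ := 1
/-- The length of the convolutions. -/
abbrev n : ℕ := 2
/-- The binary logarithm of `n`. -/
abbrev e : ℕ := 3
/-- The complexity that is being processed. -/
abbrev k : ℕ := 4
/-- The complexity of the first summand. -/
abbrev i : ℕ := 5
/-- The address in parallel assignments. -/
abbrev I : ℕ := 6
/-- The number of cells in use. -/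
abbrev T : ℕ := 7
/-- The current block length. -/
abbrev c : ℕ := 8
/-- The recursion level. -/
abbrev l : ℕ := 9
/-- The inner block length. -/
abbrev r : ℕ := 10
/-- The number of inner blocks in a block. -/
abbrev m : ℕ := 11
/-- The number of nodes of the Fourier transform. -/
abbrev q : ℕ := 12
/-- Half the length of a node. -/
abbrev h : ℕ := 13
/-- The first factor. -/
abbrev a : ℕ := 14
/-- The second factor. -/
abbrev b : ℕ := 15

/-- The array of results. -/
abbrev out : ℕ := 0
/-- The array that is transformed. -/
abbrev work : ℕ := 1
/-- The buffer for parallel assignments. -/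
abbrev buf : ℕ := 2
/-- The block lengths at the levels of the recursion. -/
abbrev lens : ℕ := 3

end Var

/-! ### Parallel assignment -/

/-- Assign to all cells `I < T` of the array `d` the value of `E`, one after the other. -/
def fill (d : ℕ) (E : Expr) : Program :=
  .seq (.assign Var.I (.const 0))
    (.loop (.op .lt (.reg Var.I) (.reg Var.T))
      (.seq (.store d (.reg Var.I) E) (.assign Var.I (.reg Var.I + .const 1))))

/-- Assign to all cells `I < T` of the array `d` the value of `E`, in parallel. -/
def mapTo (d : ℕ) (E : Expr) : Program :=
  .seq (fill Var.buf E) (fill d (.load Var.buf (.reg Var.I)))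

theorem State.reg_setReg (s : State) (r v r' : ℕ) :
    (s.setReg r v).reg r' = if r' = r then v else s.reg r' := by
  simp [State.setReg, Function.update_apply]

theorem State.arr_setReg (s : State) (r v : ℕ) : (s.setReg r v).arr = s.arr := rfl

theorem State.arr_setArr (s : State) (a i v a' i' : ℕ) :
    (s.setArr a i v).arr a' i' = if a' = a ∧ i' = i then v else s.arr a' i' := by
  by_cases h : a' = a
  · subst h
    simp [State.setArr, Function.update_apply]
  · simp [State.setArr, h]

theorem State.reg_setArr (s : State) (a i v : ℕ) : (s.setArr a i v).reg = s.reg := rfl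

/-- Because `E` does not read `d`, cells already overwritten do not influence later ones: each cell
receives the value of `E` in the initial memory, with only the address register changed. -/
theorem runs_fill {w d : ℕ} {E : Expr} {s : State} (hE : E.Avoids d = true)
    (hT : s.reg Var.T < 2 ^ w) (hw : 1 < 2 ^ w) :
    Runs w (fill d E) s ((E.cost + 10) * (s.reg Var.T + 1)) fun s' =>
      s'.reg = Function.update s.reg Var.I (s.reg Var.T) ∧
      s'.arr = Function.update s.arr d fun idx =>
        if idx < s.reg Var.T then E.eval w (s.setReg Var.I idx) else s.arr d idx := by
  set T := s.reg Var.T with hTdef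
  refine Runs.le (Runs.assign_seq (Runs.mono (Runs.loop (ι := ℕ)
    (fun k s' => k ≤ T ∧ s'.reg = Function.update s.reg Var.I k ∧
      s'.arr = Function.update s.arr d fun idx =>
        if idx < k then E.eval w (s.setReg Var.I idx) else s.arr d idx)
    (fun k => (E.cost + 10) * (T - k)) ?_ 0 ?_) le_rfl ?_)) ?_
  · rintro k s' ⟨hk, hreg, harr⟩ hcond
    have hI : s'.reg Var.I = k := by simp [hreg]
    have hT' : s'.reg Var.T = T := by simp [hreg, hTdef]
    have hlt : k < T := by
      by_contra h
      simp [Expr.eval, Op.apply, hI, hT', h] at hcond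
    have hI' : (Expr.reg Var.I).eval w s' = k := hI
    refine ⟨E.cost + 6, Runs.le (Runs.store_seq (Runs.assign ⟨k + 1, ⟨hlt, ?_, ?_⟩, ?_⟩)) ?_⟩
    all_goals try rw [hI']
    · funext x
      have h1 : (Expr.reg Var.I + Expr.const 1).eval w (s'.setArr d k (E.eval w s')) = k + 1 := by
        change ((s'.setArr d k (E.eval w s')).reg Var.I + 1 % 2 ^ w) % 2 ^ w = k + 1
        rw [State.reg_setArr, hI, Nat.mod_eq_of_lt hw, Nat.mod_eq_of_lt (by omega)]
      rw [h1, State.reg_setReg, State.reg_setArr, hreg]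
      by_cases hx : x = Var.I <;> simp [hx]
    · have h2 : E.eval w s' = E.eval w (s.setReg Var.I k) := by
        refine E.eval_congr hE ?_ fun b hb => ?_
        · rw [hreg]; rfl
        · rw [harr, State.arr_setReg, Function.update_of_ne hb]
      rw [State.arr_setReg, h2]
      funext a idx
      rw [State.arr_setArr, harr]
      by_cases ha : a = d
      · subst ha
        by_cases hidx : idx = k
        · simp [hidx]
        · have : idx ≤ k ↔ idx < k := by omega
          simp [hidx, this]
      · simp [ha]
    · have h3 : E.cost + 10 + (E.cost + 10) * (T - (k + 1)) = (E.cost + 10) * (T - k) := by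
        rw [show T - k = (T - (k + 1)) + 1 by omega]; ring
      rw [← h3]
      simp only [Expr.cost]
      omega
    · have h4 : (Expr.reg Var.I + Expr.const 1).cost = 3 := rfl
      simp only [Expr.cost]
      omega
  · refine ⟨Nat.zero_le _, ?_, ?_⟩
    · simp [Expr.eval, State.setReg]
    · simp [State.arr_setReg]
  · rintro s' ⟨k, ⟨hk, hreg, harr⟩, hcond⟩
    have hI : s'.reg Var.I = k := by simp [hreg]
    have hT' : s'.reg Var.T = T := by simp [hreg, hTdef]
    have hkT : k = T := by
      by_contra h
      have : k < T := by omega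
      simp [Expr.eval, Op.apply, hI, hT', this, Nat.mod_eq_of_lt hw] at hcond
    subst hkT
    exact ⟨hreg, harr⟩
  · simp only [Expr.cost, Nat.sub_zero]
    nlinarith

/-- The effect of a parallel assignment. -/
theorem runs_mapTo {w V d : ℕ} {E : Expr} {s : State} (hV : Roomy w V) (hs : s.Bounded V)
    (hd : d ≠ Var.buf) (hE : E.Avoids Var.buf = true) (hsmall : E.Small 10 = true)
    (hle : ∀ idx < s.reg Var.T, E.evalNat (s.setReg Var.I idx) ≤ V) :
    Runs w (mapTo d E) s ((E.cost + 22) * (s.reg Var.T + 1)) fun s' =>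
      s'.Bounded V ∧ (∀ r, r ≠ Var.I → s'.reg r = s.reg r) ∧
      (∀ a, a ≠ d → a ≠ Var.buf → s'.arr a = s.arr a) ∧
      ∀ idx, s'.arr d idx =
        if idx < s.reg Var.T then E.evalNat (s.setReg Var.I idx) else s.arr d idx := by
  have hw : 1 < 2 ^ w := hV.lt (by have := hV.four_le; omega)
  have hTV := hs.reg_le Var.T
  have hT := hV.lt hTV
  -- `E` may read its own target `d`, so its values are first collected in the buffer and then
  -- copied. The copying expression has cost 2, hence the factor 12.
  refine Runs.le (Runs.seq (runs_fill hE hT hw) fun s₁ h₁ => Runs.mono (runs_fill (s := s₁)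
    (E := .load Var.buf (.reg Var.I)) ?_ ?_ hw) ?_ ?_) (b := (E.cost + 10) * (s.reg Var.T + 1) +
      12 * (s.reg Var.T + 1)) ?_
  · simp [Expr.Avoids, hd.symm]
  · simpa [h₁.1] using hT
  · simp [h₁.1, Expr.cost]
  · rintro s₂ ⟨hreg₂, harr₂⟩
    obtain ⟨hreg₁, harr₁⟩ := h₁
    have hT₁ : s₁.reg Var.T = s.reg Var.T := by simp [hreg₁]
    rw [hT₁] at hreg₂ harr₂
    have heval : ∀ idx < s.reg Var.T, E.eval w (s.setReg Var.I idx) =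
        E.evalNat (s.setReg Var.I idx) := fun idx hidx =>
      E.eval_eq_evalNat hV (hs.setReg _ (by omega)) hsmall
    have hbuf : ∀ idx, s₂.arr Var.buf idx =
        if idx < s.reg Var.T then E.evalNat (s.setReg Var.I idx) else s.arr Var.buf idx := by
      intro idx
      rw [harr₂, Function.update_of_ne hd.symm, harr₁, Function.update_self]
      split_ifs with h
      · exact heval idx h
      · rfl
    have hdst : ∀ idx, s₂.arr d idx =
        if idx < s.reg Var.T then E.evalNat (s.setReg Var.I idx) else s.arr d idx := by
      intro idx
      rw [harr₂, Function.update_self]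
      split_ifs with h
      · rw [← heval idx h]
        simp only [Expr.eval, State.reg_setReg, State.arr_setReg, if_true, harr₁,
          Function.update_self, h]
      · rw [harr₁, Function.update_of_ne hd]
    have hrest : ∀ a, a ≠ d → a ≠ Var.buf → s₂.arr a = s.arr a := by
      intro a ha hb
      rw [harr₂, Function.update_of_ne ha, harr₁, Function.update_of_ne hb]
    refine ⟨⟨fun r => ?_, fun a i => ?_⟩, fun r hr => ?_, hrest, hdst⟩
    · rw [hreg₂, hreg₁]
      by_cases hr : r = Var.I
      · simpa [hr] using hTV
      · simpa [hr] using hs.reg_le r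
    · by_cases ha : a = d
      · subst ha
        rw [hdst]
        split_ifs with h
        · exact hle i h
        · exact hs.arr_le _ _
      · by_cases hb : a = Var.buf
        · subst hb
          rw [hbuf]
          split_ifs with h
          · exact hle i h
          · exact hs.arr_le _ _
        · rw [hrest a ha hb]
          exact hs.arr_le _ _
    · rw [hreg₂, hreg₁, Function.update_of_ne hr, Function.update_of_ne hr]
  · apply le_of_eq; ring

end WordRAM

/-! ### Negacyclic polynomials stored in arrays

Blocks of length `r` stand for the values at `y` of polynomials of degree less than `r`, where
`y ^ r = -1` in a commutative ring in which the modulus `M` vanishes. -/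

namespace Negacyclic

open Finset

/-- The block of length `r` at address `o`, evaluated at `y`. -/
def ev {S : Type*} [CommRing S] (y : S) (r : ℕ) (A : ℕ → ℕ) (o : ℕ) : S :=
  ∑ j ∈ range r, (A (o + j) : S) * y ^ j

/-- The sign `(-1) ^ (d / r)` modulo `M`, for `d < 2 * r`. -/
def sgn (M r d : ℕ) : ℕ := 1 + d / r * (M - 2)

/-- The cell of `A` that a stage of the Fourier transform and a shift move to `I`. -/
def stageVal (M r h q : ℕ) (A : ℕ → ℕ) (I : ℕ) : ℕ :=
  (A (((I / r / h / (2 * q) * q + I / r / h % q) * (2 * h) + I / r % h) * r + I % r) +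
    sgn M r ((I % r + 2 * r - I / r / h % (2 * q) * (r / q)) % (2 * r)) *
      A (((I / r / h / (2 * q) * q + I / r / h % q) * (2 * h) + I / r % h + h) * r +
        (I % r + 2 * r - I / r / h % (2 * q) * (r / q)) % (2 * r) % r)) % M

/-- Blocks of length `c = m * r` are split into `m` inner blocks of length `r`, and `m` zero
blocks are appended. -/
def padVal (m r c : ℕ) (A : ℕ → ℕ) (I : ℕ) : ℕ :=
  A (I / r / (2 * m) * c + (I / r % (2 * m) + m * (I % r))) *
    if I / r % (2 * m) < m then 1 else 0

/-- The `2 * m` inner blocks are combined into a block of length `m * r`. -/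
def unpadVal (M m r : ℕ) (A : ℕ → ℕ) (I : ℕ) : ℕ :=
  (A ((I / m / r * (2 * m) + (2 * m - I % m) % (2 * m)) * r + I / m % r) +
    sgn M r ((I / m % r + 2 * r - 1) % (2 * r)) *
      A ((I / m / r * (2 * m) + (m - I % m)) * r +
        (I / m % r + 2 * r - 1) % (2 * r) % r)) % M

/-- The product of blocks of length two in the first and the second half of the array. -/
def baseVal (M T : ℕ) (A : ℕ → ℕ) (I : ℕ) : ℕ :=
  (A (I / 2 * 2) * A (T + I / 2 * 2 + I % 2) +
    (1 + (1 - I % 2) * (M - 2)) * (A (I / 2 * 2 + 1) * A (T + I / 2 * 2 + (1 - I % 2)))) % M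

/-! ### Reindexing of finite sums. -/

theorem sum_range_add_mod {S : Type*} [AddCommMonoid S] {r : ℕ} (hr : 0 < r) (H : ℕ → S) (c : ℕ) :
    ∑ j ∈ range r, H ((j + c) % r) = ∑ j ∈ range r, H j := by
  induction c with
  | zero =>
    refine sum_congr rfl fun j hj => ?_
    rw [add_zero, Nat.mod_eq_of_lt (mem_range.1 hj)]
  | succ c ih =>
    rw [← ih]
    obtain ⟨r, rfl⟩ : ∃ k, r = k + 1 := ⟨r - 1, by omega⟩
    rw [sum_range_succ, sum_range_succ' (fun j => H ((j + c) % (r + 1)))]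
    congr 1
    · exact sum_congr rfl fun j _ => by rw [add_right_comm, add_assoc j c 1]
    · rw [show r + (c + 1) = (0 + c) + (r + 1) by ring, Nat.add_mod_right]

theorem sum_range_two_mul {S : Type*} [AddCommMonoid S] (Q : ℕ) (g : ℕ → S) :
    ∑ v ∈ range (2 * Q), g v = ∑ u ∈ range Q, (g (2 * u) + g (2 * u + 1)) := by
  induction Q with
  | zero => simp
  | succ Q ih =>
    rw [show 2 * (Q + 1) = 2 * Q + 1 + 1 by ring, sum_range_succ, sum_range_succ, ih,
      sum_range_succ, add_assoc]

theorem sum_range_mul {S : Type*} [AddCommMonoid S] (m r : ℕ) (g : ℕ → S) :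
    ∑ p ∈ range (m * r), g p = ∑ i ∈ range m, ∑ j ∈ range r, g (i + m * j) := by
  induction r with
  | zero => simp
  | succ r ih =>
    rw [mul_add, mul_one, sum_range_add, ih, ← sum_add_distrib]
    refine sum_congr rfl fun i _ => ?_
    rw [sum_range_succ, add_comm i]

/-! ### Signed shifts, Fourier transforms and convolution over a ring with y^r = -1. -/

section Ring

variable {S : Type*} [CommRing S] {M : ℕ}

theorem cast_mod (hM : (M : S) = 0) (x : ℕ) : ((x % M : ℕ) : S) = x := by
  conv_rhs => rw [← Nat.div_add_mod x M]
  push_cast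
  rw [hM]
  ring

theorem cast_sub_two (hM : (M : S) = 0) (h2 : 2 ≤ M) : ((M - 2 : ℕ) : S) = -2 := by
  rw [Nat.cast_sub h2, hM]
  push_cast
  ring

variable {y : S} {r : ℕ}

theorem pow_two_mul_eq_one (hy : y ^ r = -1) : y ^ (2 * r) = 1 := by
  rw [mul_comm, pow_mul, hy]
  ring

/-- For d < 2r the quotient d / r is 0 or 1, and M - 2 becomes -2 in S. So `sgn` is 1 or -1 there,
although the program only handles natural numbers. -/
theorem sgn_mul_pow (hM : (M : S) = 0) (h2 : 2 ≤ M) (hy : y ^ r = -1) {d : ℕ} (hd : d < 2 * r) :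
    (sgn M r d : S) * y ^ d = y ^ (d % r) := by
  have hr : 0 < r := by omega
  unfold sgn
  push_cast
  rw [cast_sub_two hM h2]
  conv_lhs => rw [← Nat.div_add_mod d r]
  rw [pow_add, pow_mul, hy]
  have hlt : d / r < 2 := (Nat.div_lt_iff_lt_mul hr).2 hd
  have hdiv : (r * (d / r) + d % r) / r = d / r := by rw [Nat.div_add_mod]
  rw [hdiv]
  interval_cases d / r
  · simp
  · simp only [Nat.cast_one, pow_one]; ring

/-- A shift with signs is a multiplication by a power of `y`. -/
theorem sum_shift (hM : (M : S) = 0) (h2 : 2 ≤ M) (hy : y ^ r = -1) (hr : 0 < r) (F : ℕ → S)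
    {a : ℕ} (ha : a < 2 * r) :
    ∑ j ∈ range r, (sgn M r ((j + 2 * r - a) % (2 * r)) : S) *
      F ((j + 2 * r - a) % (2 * r) % r) * y ^ j = y ^ a * ∑ j ∈ range r, F j * y ^ j := by
  rw [← sum_range_add_mod hr (fun j => F j * y ^ j) (2 * r - a), mul_sum]
  refine sum_congr rfl fun j hj => ?_
  have hj := mem_range.1 hj
  have hd : (j + 2 * r - a) % (2 * r) < 2 * r := Nat.mod_lt _ (by omega)
  have hmod : (j + 2 * r - a) % (2 * r) % r = (j + (2 * r - a)) % r := by
    rw [Nat.mod_mul_left_mod, Nat.add_sub_assoc ha.le]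
  have hpow : y ^ j = y ^ a * y ^ ((j + 2 * r - a) % (2 * r)) := by
    rw [← pow_add]
    rcases Nat.lt_or_ge j a with h | h
    · rw [Nat.mod_eq_of_lt (by omega), show a + (j + 2 * r - a) = j + 2 * r by omega, pow_add,
        pow_two_mul_eq_one hy, mul_one]
    · rw [show j + 2 * r - a = (j - a) + 2 * r by omega, Nat.add_mod_right,
        Nat.mod_eq_of_lt (by omega), show a + (j - a) = j by omega]
  rw [← hmod, ← sgn_mul_pow hM h2 hy hd, hpow]
  ring

theorem block_index {r b j : ℕ} (hj : j < r) : (b * r + j) % r = j ∧ (b * r + j) / r = b := by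
  constructor
  · rw [mul_comm, Nat.mul_add_mod, Nat.mod_eq_of_lt hj]
  · rw [mul_comm, Nat.mul_add_div (by omega), Nat.div_eq_of_lt hj, add_zero]

theorem block_lt {T r b B j : ℕ} (hT : T = B * r) (hb : b < B) (hj : j < r) : b * r + j < T := by
  subst hT
  calc b * r + j < b * r + r := by omega
    _ = (b + 1) * r := by ring
    _ ≤ B * r := Nat.mul_le_mul_right _ hb

/-- One butterfly stage. The twiddle factor is a power of y, so `sum_shift` turns it into moving
cells with a sign. Divisibility of r by q makes t(r/q) the right exponent and keeps it below 2r. -/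
theorem ev_stage (hM : (M : S) = 0) (h2 : 2 ≤ M) (hy : y ^ r = -1) (hr : 0 < r)
    {h q β t i T B : ℕ} (hrq : q ∣ r) (hT : T = B * (2 * q) * h * r)
    (hβ : β < B) (ht : t < 2 * q) (hi : i < h) {A A' : ℕ → ℕ}
    (hA : ∀ I < T, A' I = stageVal M r h q A I) :
    ev y r A' (((β * (2 * q) + t) * h + i) * r) =
      ev y r A (((β * q + t % q) * (2 * h) + i) * r) +
        y ^ (t * (r / q)) * ev y r A (((β * q + t % q) * (2 * h) + i + h) * r) := by
  have hq : 0 < q := by omega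
  have ha : t * (r / q) < 2 * r := by
    obtain ⟨σ, rfl⟩ := hrq
    rw [Nat.mul_div_cancel_left σ hq, ← mul_assoc]
    exact Nat.mul_lt_mul_of_pos_right ht (Nat.pos_of_mul_pos_left hr)
  unfold ev
  rw [← sum_shift hM h2 hy hr _ ha, ← sum_add_distrib]
  refine sum_congr rfl fun j hj => ?_
  have hj := mem_range.1 hj
  rw [hA _ (block_lt hT (block_lt rfl (block_lt rfl hβ ht) hi) hj), stageVal, cast_mod hM]
  obtain ⟨e1, e2⟩ := block_index (b := (β * (2 * q) + t) * h + i) hj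
  obtain ⟨e3, e4⟩ := block_index (b := β * (2 * q) + t) hi
  obtain ⟨e5, e6⟩ := block_index (b := β) ht
  have e7 : (β * (2 * q) + t) % q = t % q := by
    rw [show β * (2 * q) = q * (β * 2) by ring, Nat.mul_add_mod]
  rw [e1, e2, e3, e4, e5, e6, e7]
  push_cast
  ring

/-- Radix-two splitting into even and odd indices v. The two half-length transforms depend on t only
modulo Q, because y^(2σ) is a Q-th root of unity. -/
theorem fourier_step {σ Q h t i : ℕ} (hy : y ^ (2 * σ * Q) = 1) (f : ℕ → S) :
    ∑ v ∈ range (2 * Q), y ^ (σ * t * v) * f (i + h * v) =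
      ∑ u ∈ range Q, y ^ (2 * σ * (t % Q) * u) * f (i + 2 * h * u) +
        y ^ (t * σ) * ∑ u ∈ range Q, y ^ (2 * σ * (t % Q) * u) * f (i + h + 2 * h * u) := by
  rw [sum_range_two_mul, mul_sum, ← sum_add_distrib]
  refine sum_congr rfl fun u _ => ?_
  have h1 : y ^ (2 * σ * (t % Q) * u) = y ^ (2 * σ * t * u) := by
    conv_rhs => rw [← Nat.div_add_mod t Q]
    rw [show 2 * σ * (Q * (t / Q) + t % Q) * u =
      (2 * σ * Q) * (t / Q * u) + 2 * σ * (t % Q) * u by ring, pow_add, pow_mul y (2 * σ * Q), hy, one_pow,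
      one_mul]
  rw [h1, show i + h * (2 * u) = i + 2 * h * u by ring,
    show i + h * (2 * u + 1) = i + h + 2 * h * u by ring,
    show σ * t * (2 * u) = 2 * σ * t * u by ring,
    show σ * t * (2 * u + 1) = t * σ + 2 * σ * t * u by ring, pow_add]
  ring

/-- Orthogonality of characters in an arbitrary commutative ring, where the geometric sum cannot be
divided by ζ^k - 1. Instead the factor 1 + ζ^k is split off and the induction continues with ζ². If
the remaining sum does not vanish, ζ^k is 1 or -1. -/
theorem sum_pow_mul_eq (z : ℕ) (ζ : S) (hζ : ζ ^ 2 ^ z = -1) (k : ℕ) :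
    ∑ u ∈ range (2 * 2 ^ z), ζ ^ (u * k) = if 2 * 2 ^ z ∣ k then ((2 * 2 ^ z : ℕ) : S) else 0 := by
  induction z generalizing ζ with
  | zero =>
    obtain rfl : ζ = -1 := by simpa using hζ
    simp only [pow_zero, mul_one, sum_range_succ, range_zero, sum_empty, zero_mul, zero_add,
      one_mul]
    split_ifs with h
    · rw [(even_iff_two_dvd.2 h).neg_one_pow]; norm_num
    · rw [(Nat.not_even_iff_odd.1 (fun h' => h (even_iff_two_dvd.1 h'))).neg_one_pow]; norm_num
  | succ z ih =>
    have h2 : (ζ ^ 2) ^ 2 ^ z = -1 := by rw [← pow_mul, ← pow_succ']; exact hζ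
    have hs := ih _ h2
    rw [sum_range_two_mul]
    have : ∀ u, ζ ^ (2 * u * k) + ζ ^ ((2 * u + 1) * k) = (1 + ζ ^ k) * (ζ ^ 2) ^ (u * k) := by
      intro u
      rw [← pow_mul, add_mul (2 * u), pow_add, mul_assoc 2 u k]
      ring
    simp only [this]
    rw [← mul_sum, pow_succ', hs]
    by_cases h : 2 * 2 ^ z ∣ k
    · obtain ⟨d, rfl⟩ := h
      rw [if_pos (dvd_mul_right _ _), pow_mul, ← pow_succ', hζ]
      have hpos : 0 < 2 ^ (z + 1) := by positivity
      have hdvd : 2 * 2 ^ (z + 1) ∣ 2 ^ (z + 1) * d ↔ 2 ∣ d := by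
        rw [mul_comm 2, Nat.mul_dvd_mul_iff_left hpos]
      rw [if_congr hdvd rfl rfl]
      split_ifs with hd
      · rw [(even_iff_two_dvd.2 hd).neg_one_pow]; push_cast; ring
      · rw [(Nat.not_even_iff_odd.1 (fun h' => hd (even_iff_two_dvd.1 h'))).neg_one_pow]; ring
    · rw [if_neg h, if_neg fun h' => h ((dvd_mul_left _ _).trans h'), mul_zero]

/-- The convolution theorem for polynomials of degree less than `m`, evaluated at `x`. -/
theorem sum_fourier_mul {z m : ℕ} (hm : m = 2 ^ z) {ζ x y κ : S} (hζ : ζ ^ m = -1) (hx : x ^ m = y)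
    (a b D : ℕ → S)
    (hD : ∀ k < 2 * m, D k = ∑ t ∈ range (2 * m), ζ ^ (k * t) *
      (κ * (∑ i ∈ range m, ζ ^ (t * i) * a i) * ∑ i ∈ range m, ζ ^ (t * i) * b i)) :
    ∑ i ∈ range m, x ^ i * (D ((2 * m - i) % (2 * m)) + y * D (m - i)) =
      2 ^ (z + 1) * κ * (∑ i ∈ range m, x ^ i * a i) * ∑ i ∈ range m, x ^ i * b i := by
  have hm0 : 0 < m := hm ▸ by positivity
  have hcast : ((2 * m : ℕ) : S) = 2 ^ (z + 1) := by rw [hm]; push_cast; ring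
  -- A second forward transform, read at the reflected index -l modulo 2m, inverts the first up to
  -- the factor 2m. Both factors have only m terms, so the cyclic convolution of length 2m does not
  -- wrap around.
  have key : ∀ l < 2 * m, D ((2 * m - l) % (2 * m)) =
      2 ^ (z + 1) * κ * ∑ i ∈ range m, ∑ j ∈ range m, if i + j = l then a i * b j else 0 := by
    intro l hl
    rw [hD _ (Nat.mod_lt _ (by omega))]
    set k := (2 * m - l) % (2 * m) with hk
    have h1 : ∀ t, ζ ^ (k * t) *
        (κ * (∑ i ∈ range m, ζ ^ (t * i) * a i) * ∑ i ∈ range m, ζ ^ (t * i) * b i) =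
        ∑ i ∈ range m, ∑ j ∈ range m, κ * (a i * b j) * ζ ^ (t * (k + i + j)) := by
      intro t
      rw [mul_assoc κ, sum_mul_sum, mul_sum, mul_sum]
      refine sum_congr rfl fun i _ => ?_
      rw [mul_sum, mul_sum]
      refine sum_congr rfl fun j _ => ?_
      rw [mul_add, mul_add, pow_add, pow_add, mul_comm k t]
      ring
    simp only [h1]
    rw [sum_comm, mul_sum]
    refine sum_congr rfl fun i hi => ?_
    rw [sum_comm, mul_sum]
    refine sum_congr rfl fun j hj => ?_
    have hi := mem_range.1 hi
    have hj := mem_range.1 hj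
    rw [← mul_sum, hm, sum_pow_mul_eq z ζ (hm ▸ hζ), ← hm]
    have hiff : 2 * m ∣ k + i + j ↔ i + j = l := by
      have h3 : (k + i + j) % (2 * m) = (2 * m - l + i + j) % (2 * m) := by
        rw [hk, add_assoc, add_assoc, Nat.mod_add_mod]
      rw [Nat.dvd_iff_mod_eq_zero, h3]
      rcases Nat.lt_trichotomy (i + j) l with h | h | h
      · rw [Nat.mod_eq_of_lt (by omega)]
        omega
      · rw [show 2 * m - l + i + j = 2 * m by omega, Nat.mod_self]
        simp [h]
      · rw [show 2 * m - l + i + j = (i + j - l) + 2 * m by omega, Nat.add_mod_right,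
          Nat.mod_eq_of_lt (by omega)]
        omega
    rw [if_congr hiff rfl rfl, hcast]
    split_ifs <;> ring
  -- Index m - i is the reflection of m + i, and the factor y is x^m: the upper half of the product
  -- coefficients is folded onto the lower half.
  have h2 : ∀ i ∈ range m, x ^ i * (D ((2 * m - i) % (2 * m)) + y * D (m - i)) =
      x ^ i * D ((2 * m - i) % (2 * m)) + x ^ (m + i) * D ((2 * m - (m + i)) % (2 * m)) := by
    intro i hi
    have hi := mem_range.1 hi
    rw [show 2 * m - (m + i) = m - i by omega, Nat.mod_eq_of_lt (by omega : m - i < 2 * m),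
      pow_add, hx]
    ring
  rw [sum_congr rfl h2, sum_add_distrib,
    ← sum_range_add (fun l => x ^ l * D ((2 * m - l) % (2 * m))) m m, ← two_mul]
  have h3 : ∀ l ∈ range (2 * m), x ^ l * D ((2 * m - l) % (2 * m)) =
      ∑ i ∈ range m, ∑ j ∈ range m,
        if i + j = l then 2 ^ (z + 1) * κ * (x ^ i * a i * (x ^ j * b j)) else 0 := by
    intro l hl
    rw [key l (mem_range.1 hl), mul_sum, mul_sum]
    refine sum_congr rfl fun i _ => ?_
    rw [mul_sum, mul_sum]
    refine sum_congr rfl fun j _ => ?_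
    split_ifs with h
    · rw [← h, pow_add]; ring
    · ring
  rw [sum_congr rfl h3, sum_comm, mul_assoc, sum_mul_sum, mul_sum]
  refine sum_congr rfl fun i hi => ?_
  rw [sum_comm, mul_sum]
  refine sum_congr rfl fun j hj => ?_
  have hi := mem_range.1 hi
  have hj := mem_range.1 hj
  rw [sum_ite_eq, if_pos (mem_range.2 (by omega))]

theorem ev_mul {x y : S} {m r : ℕ} (hx : x ^ m = y) (A : ℕ → ℕ) (o : ℕ) :
    ev x (m * r) A o =
      ∑ i ∈ range m, x ^ i * ∑ j ∈ range r, (A (o + (i + m * j)) : S) * y ^ j := by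
  rw [ev, sum_range_mul]
  refine sum_congr rfl fun i _ => ?_
  rw [mul_sum]
  refine sum_congr rfl fun j _ => ?_
  rw [pow_add, pow_mul, hx]
  ring

/-- Inner block s collects the coefficients at positions s + mj, with stride m, matching `ev_mul`.
For s ≥ m the cell that is loaded is irrelevant, as it is multiplied by 0. -/
theorem ev_pad {m β s T B : ℕ} (hT : T = B * (2 * m) * r) (hβ : β < B) (hs : s < 2 * m)
    {A A' : ℕ → ℕ} (hA : ∀ I < T, A' I = padVal m r (m * r) A I) :
    ev y r A' ((β * (2 * m) + s) * r) =
      if s < m then ∑ j ∈ range r, (A (β * (m * r) + (s + m * j)) : S) * y ^ j else 0 := by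
  have h1 : ∀ j ∈ range r, (A' ((β * (2 * m) + s) * r + j) : S) * y ^ j =
      if s < m then (A (β * (m * r) + (s + m * j)) : S) * y ^ j else 0 := by
    intro j hj
    have hj := mem_range.1 hj
    rw [hA _ (block_lt hT (block_lt rfl hβ hs) hj), padVal]
    obtain ⟨e1, e2⟩ := block_index (b := β * (2 * m) + s) hj
    obtain ⟨e3, e4⟩ := block_index (b := β) hs
    rw [e1, e2, e3, e4]
    split_ifs <;> simp
  rw [ev, sum_congr rfl h1]
  split_ifs <;> simp

/-- The factor y before the upper half is a signed shift by one place, which explains the offset 1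
in `unpadVal`. -/
theorem ev_unpad (hM : (M : S) = 0) (h2 : 2 ≤ M) (hy : y ^ r = -1) (hr : 0 < r) {x : S}
    {m β T B : ℕ} (hx : x ^ m = y) (hT : T = B * r * m) (hβ : β < B)
    {A A' : ℕ → ℕ} (hA : ∀ I < T, A' I = unpadVal M m r A I) :
    ev x (m * r) A' (β * (m * r)) = ∑ i ∈ range m, x ^ i *
      (ev y r A ((β * (2 * m) + (2 * m - i) % (2 * m)) * r) +
        y * ev y r A ((β * (2 * m) + (m - i)) * r)) := by
  rw [ev_mul hx]
  refine sum_congr rfl fun i hi => ?_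
  have hi := mem_range.1 hi
  congr 1
  unfold ev
  have hsh := sum_shift hM h2 hy hr
    (fun j => (A ((β * (2 * m) + (m - i)) * r + j) : S)) (a := 1) (by omega)
  rw [pow_one] at hsh
  rw [← hsh, ← sum_add_distrib]
  refine sum_congr rfl fun j hj => ?_
  have hj := mem_range.1 hj
  rw [show β * (m * r) + (i + m * j) = (β * r + j) * m + i by ring,
    hA _ (block_lt hT (block_lt rfl hβ hj) hi), unpadVal, cast_mod hM]
  obtain ⟨e1, e2⟩ := block_index (b := β * r + j) hi
  obtain ⟨e3, e4⟩ := block_index (b := β) hj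
  rw [e1, e2, e3, e4]
  push_cast
  ring

theorem ev_base (hM : (M : S) = 0) (h2 : 2 ≤ M) (hy : y ^ 2 = -1) {β T : ℕ} (hβ : β * 2 + 1 < T)
    {A A' : ℕ → ℕ} (hA : ∀ I < T, A' I = baseVal M T A I) :
    ev y 2 A' (β * 2) = ev y 2 A (β * 2) * ev y 2 A (T + β * 2) := by
  simp only [ev, sum_range_succ, range_zero, sum_empty, zero_add, add_zero, pow_zero, mul_one,
    pow_one]
  rw [hA _ hβ, hA _ (by omega), baseVal, baseVal, cast_mod hM, cast_mod hM]
  have e1 : β * 2 / 2 = β := by omega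
  have e2 : β * 2 % 2 = 0 := by omega
  have e3 : (β * 2 + 1) / 2 = β := by omega
  have e4 : (β * 2 + 1) % 2 = 1 := by omega
  rw [e1, e2, e3, e4]
  push_cast
  rw [cast_sub_two hM h2]
  simp only [add_zero]
  linear_combination (-(A (β * 2 + 1) : S) * A (T + β * 2 + 1)) * hy

end Ring

end Negacyclic

namespace WordRAM

open Negacyclic Finset

/-! ### The Fourier transform -/

/-- The states agree outside the registers in `R` and the arrays in `A`. -/
structure Frame (R A : List ℕ) (s s' : State) : Prop where
  reg : ∀ r, r ∉ R → s'.reg r = s.reg r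
  arr : ∀ a, a ∉ A → s'.arr a = s.arr a

theorem Frame.refl (R A : List ℕ) (s : State) : Frame R A s s := ⟨fun _ _ => rfl, fun _ _ => rfl⟩

theorem Frame.trans {R A : List ℕ} {s s' s'' : State} (h : Frame R A s s') (h' : Frame R A s' s'') :
    Frame R A s s'' :=
  ⟨fun r hr => (h'.reg r hr).trans (h.reg r hr), fun a ha => (h'.arr a ha).trans (h.arr a ha)⟩

theorem Frame.mono {R A R' A' : List ℕ} {s s' : State} (h : Frame R A s s') (hR : R ⊆ R')
    (hA : A ⊆ A') : Frame R' A' s s' :=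
  ⟨fun r hr => h.reg r fun h' => hr (hR h'), fun a ha => h.arr a fun h' => ha (hA h')⟩

theorem Frame.setReg {R A : List ℕ} {s s' : State} (h : Frame R A s s') {r : ℕ} (hr : r ∈ R)
    (v : ℕ) : Frame R A s (s'.setReg r v) := by
  refine ⟨fun r' hr' => ?_, h.arr⟩
  rw [State.reg_setReg, if_neg (by rintro rfl; exact hr' hr), h.reg r' hr']

theorem Frame.setArr {R A : List ℕ} {s s' : State} (h : Frame R A s s') {a : ℕ} (ha : a ∈ A)
    (i v : ℕ) : Frame R A s (s'.setArr a i v) := by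
  refine ⟨h.reg, fun a' ha' => ?_⟩
  funext i'
  rw [State.arr_setArr, if_neg (by rintro ⟨rfl, -⟩; exact ha' ha), h.arr a' ha']

/-- The effect of a parallel assignment with a frame. -/
theorem runs_mapTo_frame {w V d : ℕ} {E : Expr} {s : State} (hV : Roomy w V) (hs : s.Bounded V)
    (hd : d ≠ Var.buf) (hE : E.Avoids Var.buf = true) (hsmall : E.Small 10 = true)
    (hle : ∀ idx < s.reg Var.T, E.evalNat (s.setReg Var.I idx) ≤ V) :
    Runs w (mapTo d E) s ((E.cost + 22) * (s.reg Var.T + 1)) fun s' =>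
      s'.Bounded V ∧ Frame [Var.I] [d, Var.buf] s s' ∧
      ∀ idx < s.reg Var.T, s'.arr d idx = E.evalNat (s.setReg Var.I idx) := by
  refine (runs_mapTo hV hs hd hE hsmall hle).mono le_rfl ?_
  rintro s' ⟨h1, h2, h3, h4⟩
  refine ⟨h1, ⟨fun r hr => h2 r (by simpa using hr), fun a ha => ?_⟩,
    fun idx hidx => by rw [h4, if_pos hidx]⟩
  simp only [List.mem_cons, List.not_mem_nil, or_false, not_or] at ha
  exact h3 a ha.1 ha.2

/-- The sign `(-1) ^ (d / r)`. -/
def sgnExpr (d : Expr) : Expr := .const 1 + d / .reg Var.r * (.reg Var.M - .const 2)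

/-- A stage of the Fourier transform. -/
def stageExpr : Expr :=
  let I := Expr.reg Var.I
  let r := Expr.reg Var.r
  let h := Expr.reg Var.h
  let q := Expr.reg Var.q
  let two := Expr.const 2
  let d := (I % r + two * r - I / r / h % (two * q) * (r / q)) % (two * r)
  (.load Var.work (((I / r / h / (two * q) * q + I / r / h % q) * (two * h) + I / r % h) * r +
      I % r) +
    sgnExpr d * .load Var.work (((I / r / h / (two * q) * q + I / r / h % q) * (two * h) +
      I / r % h + h) * r + d % r)) % .reg Var.M

theorem evalNat_stageExpr (s : State) : stageExpr.evalNat s =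
    stageVal (s.reg Var.M) (s.reg Var.r) (s.reg Var.h) (s.reg Var.q) (s.arr Var.work)
      (s.reg Var.I) := rfl

/-- The splitting of blocks into padded inner blocks. -/
def padExpr : Expr :=
  let I := Expr.reg Var.I
  let r := Expr.reg Var.r
  let m := Expr.reg Var.m
  let two := Expr.const 2
  .load Var.work (I / r / (two * m) * .reg Var.c + (I / r % (two * m) + m * (I % r))) *
    .op .lt (I / r % (two * m)) m

theorem evalNat_padExpr (s : State) : padExpr.evalNat s =
    padVal (s.reg Var.m) (s.reg Var.r) (s.reg Var.c) (s.arr Var.work) (s.reg Var.I) := rfl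

/-- The combination of inner blocks into blocks. -/
def unpadExpr : Expr :=
  let I := Expr.reg Var.I
  let r := Expr.reg Var.r
  let m := Expr.reg Var.m
  let two := Expr.const 2
  let d := (I / m % r + two * r - .const 1) % (two * r)
  (.load Var.work ((I / m / r * (two * m) + (two * m - I % m) % (two * m)) * r + I / m % r) +
    sgnExpr d * .load Var.work ((I / m / r * (two * m) + (m - I % m)) * r + d % r)) %
      .reg Var.M

theorem evalNat_unpadExpr (s : State) : unpadExpr.evalNat s =
    unpadVal (s.reg Var.M) (s.reg Var.m) (s.reg Var.r) (s.arr Var.work) (s.reg Var.I) := rfl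

/-- The product of the blocks of length two. -/
def baseExpr : Expr :=
  let I := Expr.reg Var.I
  let T := Expr.reg Var.T
  let one := Expr.const 1
  let two := Expr.const 2
  (.load Var.work (I / two * two) * .load Var.work (T + I / two * two + I % two) +
    (one + (one - I % two) * (.reg Var.M - two)) * (.load Var.work (I / two * two + one) *
      .load Var.work (T + I / two * two + (one - I % two)))) % .reg Var.M

theorem evalNat_baseExpr (s : State) : baseExpr.evalNat s =
    baseVal (s.reg Var.M) (s.reg Var.T) (s.arr Var.work) (s.reg Var.I) := rfl

/-- The Fourier transform of length `2 * m` of vectors of blocks of length `r`. -/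
def dft : Program :=
  .seq (.assign Var.q (.const 1)) (.seq (.assign Var.h (.reg Var.m))
    (.loop (.reg Var.h) (.seq (mapTo Var.work stageExpr)
      (.seq (.assign Var.q (.const 2 * .reg Var.q)) (.assign Var.h (.reg Var.h / .const 2))))))

/-- An iterative self-sorting transform: parallel assignment lets each stage move the blocks, so no
bit reversal is needed. The root of unity of order dividing 2m is y^(r/m), which requires m ≤ r. -/
theorem runs_dft {w V : ℕ} (hV : Roomy w V) {s : State} (hs : s.Bounded V) {x z B : ℕ}
    (hzx : z ≤ x) (hB : 0 < B) (hr : s.reg Var.r = 2 ^ x) (hm : s.reg Var.m = 2 ^ z)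
    (hT : s.reg Var.T = B * (2 * 2 ^ z) * 2 ^ x) (h2 : 2 ≤ s.reg Var.M) {S : Type*} [CommRing S]
    (hM : (s.reg Var.M : S) = 0) {y : S} (hy : y ^ 2 ^ x = -1) :
    Runs w dft s (300 * (z + 2) * (s.reg Var.T + 1)) fun s' =>
      s'.Bounded V ∧ Frame [Var.I, Var.q, Var.h] [Var.work, Var.buf] s s' ∧
      ∀ β < B, ∀ t < 2 * 2 ^ z, ev y (2 ^ x) (s'.arr Var.work) ((β * (2 * 2 ^ z) + t) * 2 ^ x) =
        ∑ u ∈ range (2 * 2 ^ z), y ^ (2 ^ (x - z) * t * u) *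
          ev y (2 ^ x) (s.arr Var.work) ((β * (2 * 2 ^ z) + u) * 2 ^ x) := by
  have hV4 := hV.four_le
  have hqV : 2 * 2 ^ z ≤ V := by
    refine le_trans ?_ (hT ▸ hs.reg_le Var.T)
    have := Nat.mul_le_mul hB (Nat.one_le_two_pow (n := x))
    nlinarith [Nat.one_le_two_pow (n := z)]
  set s₀ := (s.setReg Var.q 1).setReg Var.h (2 ^ z) with hs₀
  have hs₀b : s₀.Bounded V := (hs.setReg _ (by omega)).setReg _ (by omega)
  have hcost : stageExpr.cost ≤ 200 := by decide
  -- After p stages, each residue i modulo 2^(z+1-p) carries the transform of length 2^p of the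
  -- blocks with indices in that residue class. Initially p = 0 and these are the blocks themselves.
  -- The halved length h reaches 0 exactly at p = z + 1, when the transform has full length 2m.
  have hloop := Runs.loop (w := w) (s := s₀) (e := .reg Var.h)
    (P := .seq (mapTo Var.work stageExpr)
      (.seq (.assign Var.q (.const 2 * .reg Var.q)) (.assign Var.h (.reg Var.h / .const 2))))
    (fun p s' => p ≤ z + 1 ∧ s'.Bounded V ∧
      Frame [Var.I, Var.q, Var.h] [Var.work, Var.buf] s s' ∧ s'.reg Var.q = 2 ^ p ∧
      s'.reg Var.h = 2 ^ z / 2 ^ p ∧ ∀ β < B, ∀ t < 2 ^ p, ∀ i < 2 ^ (z + 1 - p),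
        ev y (2 ^ x) (s'.arr Var.work) (((β * 2 ^ p + t) * 2 ^ (z + 1 - p) + i) * 2 ^ x) =
          ∑ u ∈ range (2 ^ p), y ^ (2 ^ (x + 1 - p) * t * u) *
            ev y (2 ^ x) (s.arr Var.work)
              ((β * (2 * 2 ^ z) + (i + 2 ^ (z + 1 - p) * u)) * 2 ^ x))
    (fun p => (z + 1 - p) * (240 * (s.reg Var.T + 1))) ?_ 0 ?_
  · refine Runs.le (Runs.assignNat_seq hV hs (by decide) (Runs.assignNat_seq hV
      (hs.setReg _ (by simp only [Expr.evalNat]; omega)) (by decide) ?_))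
      (b := 2 + (2 + ((z + 1 - 0) * (240 * (s.reg Var.T + 1)) + 1 + 1))) ?_
    · have h1 : ((s.setReg Var.q ((Expr.const 1).evalNat s)).setReg Var.h
          ((Expr.reg Var.m).evalNat (s.setReg Var.q ((Expr.const 1).evalNat s)))) = s₀ := by
        rw [hs₀, ← hm]; rfl
      rw [h1]
      refine hloop.mono le_rfl ?_
      rintro s' ⟨p, ⟨hp, hb, hF, hq, hh, hev⟩, h0⟩
      have hp' : p = z + 1 := by
        by_contra hne
        have h0' : s'.reg Var.h = 0 := h0
        rw [hh, Nat.pow_div (by omega) (by norm_num)] at h0'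
        exact absurd h0' (by positivity)
      subst hp'
      refine ⟨hb, hF, fun β hβ t ht => ?_⟩
      have := hev β hβ t (by rw [pow_succ']; exact ht) 0 (by simp)
      simp only [Nat.sub_self, pow_zero, mul_one, add_zero, zero_add, one_mul,
        show x + 1 - (z + 1) = x - z by omega, pow_succ' 2 z] at this
      exact this
    · rw [Nat.sub_zero]
      have h5 : 300 * (z + 2) * (s.reg Var.T + 1) = (z + 1) * (240 * (s.reg Var.T + 1)) +
        (60 * (z + 1) + 300) * (s.reg Var.T + 1) := by ring
      have h6 := Nat.le_mul_of_pos_right (60 * (z + 1) + 300) (by omega : 0 < s.reg Var.T + 1)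
      omega
  · rintro p s' ⟨hp, hb, hF, hq, hh, hev⟩ hne
    have hpz : p ≤ z := by
      by_contra hlt
      apply hne
      change s'.reg Var.h = 0
      rw [hh]
      exact Nat.div_eq_of_lt (Nat.pow_lt_pow_right (by norm_num) (by omega))
    have hh' : s'.reg Var.h = 2 ^ (z - p) := by rw [hh, Nat.pow_div hpz (by norm_num)]
    have hT' : s'.reg Var.T = s.reg Var.T := hF.reg _ (by decide)
    have hM' : s'.reg Var.M = s.reg Var.M := hF.reg _ (by decide)
    have hr' : s'.reg Var.r = 2 ^ x := (hF.reg _ (by decide)).trans hr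
    have hmap := runs_mapTo_frame (d := Var.work) (E := stageExpr) hV hb (by decide) (by decide)
      (by decide) fun idx _ => by
        rw [evalNat_stageExpr]
        refine (Nat.mod_lt _ ?_).le.trans (hb.reg_le Var.M)
        change 0 < s'.reg Var.M
        omega
    refine ⟨222 * (s.reg Var.T + 1) + (4 + (4 + 0)), Runs.seq (Runs.le hmap ?_)
      (Q' := fun s' => ∃ g', _ ∧ _) fun s'' h'' =>
      Runs.le (Runs.assignNat_seq hV h''.1 (by decide) (Runs.assignNat hV
        (h''.1.setReg _ ?_) (by decide) ⟨p + 1, ⟨by omega, ?_, ?_, ?_, ?_, ?_⟩, ?_⟩)) le_rfl⟩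
    · rw [hT']
      exact Nat.mul_le_mul (by omega) le_rfl
    all_goals
      have hq'' : s''.reg Var.q = 2 ^ p := (h''.2.1.reg _ (by decide)).trans hq
      have hh'' : s''.reg Var.h = 2 ^ (z - p) := (h''.2.1.reg _ (by decide)).trans hh'
      have e1 : (Expr.const 2 * Expr.reg Var.q).evalNat s'' = 2 ^ (p + 1) := by
        rw [pow_succ', ← hq'']; rfl
      have hle : 2 ^ (p + 1) ≤ V := by
        refine le_trans ?_ hqV
        rw [← pow_succ']
        exact Nat.pow_le_pow_right (by norm_num) (by omega)
    · rw [e1]; exact hle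
    · refine (h''.1.setReg _ (by rw [e1]; exact hle)).setReg _ ?_
      refine (Nat.div_le_self _ _).trans ?_
      exact h''.1.reg_le Var.h
    · exact ((hF.trans (h''.2.1.mono (by decide) (by decide))).setReg (by decide) _).setReg
        (by decide) _
    · exact e1
    · change s''.reg Var.h / 2 = _
      rw [hh'', pow_succ, ← Nat.div_div_eq_div_mul, Nat.pow_div hpz (by norm_num)]
    · intro β hβ t ht i hi
      change ev y (2 ^ x) (s''.arr Var.work) _ = _
      have hstage := ev_stage (A := s'.arr Var.work) (A' := s''.arr Var.work) hM h2 hy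
        (by positivity) (h := 2 ^ (z - p)) (q := 2 ^ p) (T := s.reg Var.T) (B := B) (β := β)
        (t := t) (i := i) (pow_dvd_pow 2 (hpz.trans hzx)) ?_ hβ (by rw [← pow_succ']; exact ht)
        (by rw [show z - p = z + 1 - (p + 1) by omega]; exact hi) ?_
      · rw [show z + 1 - (p + 1) = z - p by omega, pow_succ' 2 p, hstage]
        have hpow : 2 * 2 ^ (z - p) = 2 ^ (z + 1 - p) := by
          rw [← pow_succ', show z - p + 1 = z + 1 - p by omega]
        have hi1 : i < 2 ^ (z - p) := by
          rw [show z - p = z + 1 - (p + 1) by omega]; exact hi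
        have htp : t % 2 ^ p < 2 ^ p := Nat.mod_lt _ (by positivity)
        have hstep := fourier_step (y := y) (σ := 2 ^ (x - p)) (Q := 2 ^ p) (h := 2 ^ (z - p))
          (t := t) (i := i) ?_ fun u => ev y (2 ^ x) (s.arr Var.work)
            ((β * (2 * 2 ^ z) + u) * 2 ^ x)
        · rw [hpow, add_assoc _ i, hev β hβ _ htp i (by omega),
            hev β hβ _ htp (i + 2 ^ (z - p)) (by omega), Nat.pow_div (hpz.trans hzx) (by norm_num),
            show x + 1 - (p + 1) = x - p by omega, hstep, hpow,
            show 2 * 2 ^ (x - p) = 2 ^ (x + 1 - p) by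
              rw [← pow_succ', show x - p + 1 = x + 1 - p by omega]]
        · rw [mul_assoc, ← pow_add, show x - p + p = x by omega]
          exact pow_two_mul_eq_one hy
      · rw [hT]
        have : 2 ^ z = 2 ^ p * 2 ^ (z - p) := by rw [← pow_add, show p + (z - p) = z by omega]
        rw [this]
        ring
      · intro I hI
        rw [h''.2.2 I (by rw [hT']; exact hI), evalNat_stageExpr]
        change stageVal (s'.reg Var.M) (s'.reg Var.r) (s'.reg Var.h) (s'.reg Var.q)
          (s'.arr Var.work) I = _
        rw [hM', hr', hh', hq]
    · have e2 : (Expr.reg Var.h).cost = 1 := rfl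
      have h3 : z + 1 - p = (z + 1 - (p + 1)) + 1 := by omega
      simp only [e2]
      rw [h3, Nat.add_mul]
      omega
  · refine ⟨by omega, hs₀b, ?_, ?_, ?_, ?_⟩
    · exact ((Frame.refl _ _ s).setReg (by decide) _).setReg (by decide) _
    · simp only [pow_zero]; rfl
    · simp only [pow_zero, Nat.div_one]; rfl
    · intro β hβ t ht i hi
      obtain rfl : t = 0 := by simpa using ht
      simp only [pow_zero, mul_one, Nat.sub_zero, range_one, sum_singleton, mul_zero, add_zero,
        one_mul, pow_succ' 2 z]
      rfl

/-- Write the block length as `m * r` with powers of two `m ≤ r ≤ 2 * m`. -/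
def split : Program :=
  .seq (.assign Var.r (.const 2)) (.seq (.assign Var.m (.reg Var.c / .const 2))
    (.loop (.op .lt (.reg Var.r) (.reg Var.m))
      (.seq (.assign Var.r (.const 2 * .reg Var.r)) (.assign Var.m (.reg Var.m / .const 2)))))

theorem runs_split {w V : ℕ} (hV : Roomy w V) {s : State} (hs : s.Bounded V) {E : ℕ} (hE : 2 ≤ E)
    (hc : s.reg Var.c = 2 ^ E) :
    Runs w split s (20 * (E + 1)) fun s' =>
      s'.Bounded V ∧ Frame [Var.r, Var.m] [] s s' ∧
      s'.reg Var.r = 2 ^ ((E + 1) / 2) ∧ s'.reg Var.m = 2 ^ (E / 2) := by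
  have hV4 := hV.four_le
  have hcV := hs.reg_le Var.c
  have hp : ∀ x ≤ E, 2 ^ x ≤ V := fun x hx =>
    (Nat.pow_le_pow_right (by norm_num) hx).trans (hc ▸ hcV)
  set s₀ := (s.setReg Var.r 2).setReg Var.m (2 ^ E / 2) with hs₀
  have hloop := Runs.loop (w := w) (s := s₀) (e := .op .lt (.reg Var.r) (.reg Var.m))
    (P := .seq (.assign Var.r (.const 2 * .reg Var.r)) (.assign Var.m (.reg Var.m / .const 2)))
    -- The bound E ≤ 2z + 1 says that z has not been lowered too far; the exit condition m ≤ r gives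
    -- 2z ≤ E, so z = E / 2.
    (fun z s' => z < E ∧ E ≤ 2 * z + 1 ∧ s'.Bounded V ∧ Frame [Var.r, Var.m] [] s s' ∧
      s'.reg Var.r = 2 ^ (E - z) ∧ s'.reg Var.m = 2 ^ z) (fun z => 20 * z) ?_ (E - 1) ?_
  · refine Runs.le (Runs.assignNat_seq hV hs (by decide) (Runs.assignNat_seq hV
      (hs.setReg _ (by simp only [Expr.evalNat]; omega)) (by decide) ?_))
      (b := 2 + (4 + (20 * (E - 1) + 3 + 1))) ?_
    · have h1 : ((s.setReg Var.r ((Expr.const 2).evalNat s)).setReg Var.m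
          ((Expr.reg Var.c / .const 2).evalNat (s.setReg Var.r ((Expr.const 2).evalNat s)))) =
          s₀ := by
        rw [hs₀, ← hc]; rfl
      rw [h1]
      refine hloop.mono le_rfl ?_
      rintro s' ⟨z, ⟨hz1, hz2, hb, hF, hr, hm⟩, h0⟩
      rw [Expr.eval_lt_eq_zero hV hb _ _ (by decide), evalNat_reg, evalNat_reg, hr, hm,
        Nat.pow_le_pow_iff_right (by norm_num)] at h0
      refine ⟨hb, hF, ?_, ?_⟩
      · rw [hr]; congr 1; omega
      · rw [hm]; congr 1; omega
    · omega
  · rintro z s' ⟨hz1, hz2, hb, hF, hr, hm⟩ hne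
    rw [Ne, Expr.eval_lt_eq_zero hV hb _ _ (by decide), evalNat_reg, evalNat_reg, hr, hm,
      Nat.pow_le_pow_iff_right (by norm_num)] at hne
    have e1 : (Expr.const 2 * Expr.reg Var.r).evalNat s' = 2 ^ (E - (z - 1)) := by
      rw [show E - (z - 1) = E - z + 1 by omega, pow_succ', ← hr]; rfl
    refine ⟨4 + 4, Runs.le (Runs.assignNat_seq hV hb (by decide) (Runs.assignNat hV
        (hb.setReg _ ?_) (by decide) ⟨z - 1, ⟨by omega, by omega, ?_, ?_, e1, ?_⟩, ?_⟩)) le_rfl⟩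
    · rw [e1]; exact hp _ (by omega)
    · refine (hb.setReg _ ?_).setReg _ ?_
      · rw [e1]; exact hp _ (by omega)
      · exact (Nat.div_le_self _ _).trans (hb.reg_le Var.m)
    · exact (hF.setReg (by decide) _).setReg (by decide) _
    · change s'.reg Var.m / 2 = _
      rw [hm]
      obtain ⟨z, rfl⟩ : ∃ k, z = k + 1 := ⟨z - 1, by omega⟩
      rw [pow_succ, Nat.mul_div_cancel _ (by norm_num), Nat.add_sub_cancel]
    · simp only [Expr.cost]
      omega
  · have h2 : 2 ^ E / 2 = 2 ^ (E - 1) := by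
      obtain ⟨E, rfl⟩ : ∃ k, E = k + 1 := ⟨E - 1, by omega⟩
      rw [pow_succ, Nat.mul_div_cancel _ (by norm_num), Nat.add_sub_cancel]
    refine ⟨by omega, by omega, (hs.setReg _ (by omega)).setReg _ ?_,
      ((Frame.refl _ _ s).setReg (by decide) _).setReg (by decide) _, ?_, ?_⟩
    · rw [h2]; exact hp _ (by omega)
    · rw [show E - (E - 1) = 1 by omega]; rfl
    · rw [← h2]; rfl

end WordRAM

namespace WordRAM

open Negacyclic Finset

/-! ### One level of the recursion -/

/-- Split all blocks into inner blocks, pad them and transform. -/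
def forwardStep : Program :=
  .seq split (.seq (.assign Var.T (.const 2 * .reg Var.T)) (.seq (mapTo Var.work padExpr)
    (.seq dft (.seq (.assign Var.c (.reg Var.r)) (.seq (.assign Var.l (.reg Var.l + .const 1))
      (.store Var.lens (.reg Var.l) (.reg Var.c)))))))

/-- Transform back and combine the inner blocks. -/
def backwardStep : Program :=
  .seq (.assign Var.r (.load Var.lens (.reg Var.l)))
    (.seq (.assign Var.l (.reg Var.l - .const 1))
      (.seq (.assign Var.c (.load Var.lens (.reg Var.l)))
        (.seq (.assign Var.m (.reg Var.c / .reg Var.r))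
          (.seq dft (.seq (.assign Var.T (.reg Var.T / .const 2)) (mapTo Var.work unpadExpr))))))

/-- The elements a_i are the values at y of the strided subpolynomials of a block. The padded half
contributes nothing, so the transform of length 2m is a sum over m terms. -/
theorem runs_forwardStep {w V : ℕ} (hV : Roomy w V) {s : State} (hs : s.Bounded V) {E B : ℕ}
    (hE : 2 ≤ E) (hB : 0 < B) (hc : s.reg Var.c = 2 ^ E) (hT : s.reg Var.T = B * 2 ^ E)
    (hTV : 2 * s.reg Var.T ≤ V) (hl : s.reg Var.l + 1 ≤ V) (h2 : 2 ≤ s.reg Var.M)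
    {S : Type*} [CommRing S] (hM : (s.reg Var.M : S) = 0) {X y : S} (hX : X ^ 2 ^ (E / 2) = y)
    (hy : y ^ 2 ^ ((E + 1) / 2) = -1) :
    Runs w forwardStep s (500 * (E + 2) * (2 * s.reg Var.T + 1)) fun s' =>
      s'.Bounded V ∧ Frame [Var.I, Var.q, Var.h, Var.r, Var.m, Var.T, Var.c, Var.l]
        [Var.work, Var.buf, Var.lens] s s' ∧
      s'.reg Var.c = 2 ^ ((E + 1) / 2) ∧ s'.reg Var.l = s.reg Var.l + 1 ∧
      s'.reg Var.T = 2 * s.reg Var.T ∧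
      (∀ i, s'.arr Var.lens i =
        if i = s.reg Var.l + 1 then 2 ^ ((E + 1) / 2) else s.arr Var.lens i) ∧
      ∀ β < B, ∃ a : ℕ → S,
        ev X (2 ^ E) (s.arr Var.work) (β * 2 ^ E) = ∑ i ∈ range (2 ^ (E / 2)), X ^ i * a i ∧
        ∀ t < 2 * 2 ^ (E / 2),
          ev y (2 ^ ((E + 1) / 2)) (s'.arr Var.work)
            ((β * (2 * 2 ^ (E / 2)) + t) * 2 ^ ((E + 1) / 2)) =
          ∑ i ∈ range (2 ^ (E / 2)), y ^ (2 ^ ((E + 1) / 2 - E / 2) * t * i) * a i := by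
  set x := (E + 1) / 2 with hx
  set z := E / 2 with hz
  have hmr : 2 ^ z * 2 ^ x = 2 ^ E := by rw [← pow_add]; congr 1; omega
  set T := s.reg Var.T with hTdef
  have hsplit := runs_split hV hs hE hc
  have hcost : padExpr.cost ≤ 200 := by decide
  refine Runs.le (Runs.seq hsplit fun s₁ h₁ => Runs.assignNat_seq hV h₁.1 (by decide) ?_)
    (b := 20 * (E + 1) + (4 + (222 * (2 * T + 1) +
      (300 * (z + 2) * (2 * T + 1) + (2 + (4 + 3)))))) ?_
  swap
  · have h3 : 500 * (E + 2) * (2 * T + 1) = 300 * (z + 2) * (2 * T + 1) + 222 * (2 * T + 1) +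
        (500 * E - 300 * z + 178) * (2 * T + 1) := by
      have : 500 * (E + 2) = 300 * (z + 2) + 222 + (500 * E - 300 * z + 178) := by omega
      rw [this]; ring
    have h4 := Nat.le_mul_of_pos_right (500 * E - 300 * z + 178) (by omega : 0 < 2 * T + 1)
    omega
  obtain ⟨hb₁, hF₁, hr₁, hm₁⟩ := h₁
  have hT₁ : s₁.reg Var.T = T := hF₁.reg _ (by decide)
  have e1 : (Expr.const 2 * Expr.reg Var.T).evalNat s₁ = 2 * T := by rw [← hT₁]; rfl
  rw [e1]
  set s₂ := s₁.setReg Var.T (2 * T) with hs₂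
  have hb₂ : s₂.Bounded V := hb₁.setReg _ hTV
  have hF₂ : Frame [Var.r, Var.m, Var.T] [] s s₂ :=
    (hF₁.mono (by decide) (by decide)).setReg (by decide) _
  have hT₂ : s₂.reg Var.T = 2 * T := rfl
  have hr₂ : s₂.reg Var.r = 2 ^ x := hr₁
  have hm₂ : s₂.reg Var.m = 2 ^ z := hm₁
  have hc₂ : s₂.reg Var.c = 2 ^ E := (hF₂.reg _ (by decide)).trans hc
  have hmap := runs_mapTo_frame (s := s₂) (d := Var.work) (E := padExpr) hV hb₂ (by decide)
    (by decide) (by decide) fun idx _ => by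
      rw [evalNat_padExpr, padVal]
      split_ifs
      · rw [mul_one]; exact hb₂.arr_le _ _
      · rw [mul_zero]; exact Nat.zero_le _
  refine Runs.seq (hmap.le (Nat.mul_le_mul (by omega) (by rw [hT₂]))) ?_
  rintro s₃ ⟨hb₃, hF₃, hA₃⟩
  have hT₃ : s₃.reg Var.T = B * (2 * 2 ^ z) * 2 ^ x := by
    rw [hF₃.reg _ (by decide), hT₂, hT, ← hmr]; ring
  have hT₃' : s₃.reg Var.T = 2 * T := hF₃.reg _ (by decide)
  have hr₃ : s₃.reg Var.r = 2 ^ x := (hF₃.reg _ (by decide)).trans hr₂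
  have hm₃ : s₃.reg Var.m = 2 ^ z := (hF₃.reg _ (by decide)).trans hm₂
  have hF₃' : Frame [Var.I, Var.r, Var.m, Var.T] [Var.work, Var.buf] s s₃ :=
    (hF₂.mono (by decide) (by decide)).trans (hF₃.mono (by decide) (by decide))
  have hM₃ : s₃.reg Var.M = s.reg Var.M := hF₃'.reg _ (by decide)
  have hdft := runs_dft hV hb₃ (x := x) (z := z) (by omega) hB hr₃ hm₃ hT₃ (hM₃ ▸ h2)
    (hM₃ ▸ hM) hy
  rw [hT₃'] at hdft
  refine Runs.seq hdft ?_
  rintro s₄ ⟨hb₄, hF₄, hA₄⟩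
  have hF₄' : Frame [Var.I, Var.q, Var.h, Var.r, Var.m, Var.T] [Var.work, Var.buf] s s₄ :=
    (hF₃'.mono (by decide) (by decide)).trans (hF₄.mono (by decide) (by decide))
  have hr₄ : s₄.reg Var.r = 2 ^ x := (hF₄.reg _ (by decide)).trans hr₃
  have hl₄ : s₄.reg Var.l = s.reg Var.l := hF₄'.reg _ (by decide)
  have hT₄ : s₄.reg Var.T = 2 * T := (hF₄.reg _ (by decide)).trans hT₃'
  have hb₅ := hb₄.setReg Var.c (hb₄.reg_le Var.r)
  have hl₅ : (Expr.reg Var.l + Expr.const 1).evalNat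
      (s₄.setReg Var.c ((Expr.reg Var.r).evalNat s₄)) = s.reg Var.l + 1 := by
    rw [← hl₄]; rfl
  have hb₆ := hb₅.setReg Var.l (hl₅.le.trans hl)
  refine Runs.assignNat_seq hV hb₄ (by decide) (Runs.assignNat_seq hV hb₅ (by decide)
    (Runs.storeNat hV hb₆ (by decide) (by decide) ?_))
  refine ⟨hb₆.setArr _ _ (hb₆.reg_le Var.c), ?_, hr₄, hl₅, hT₄, ?_, ?_⟩
  · exact (((hF₄'.mono (by decide) (by decide)).setReg (by decide) _).setReg (by decide)
      _).setArr (by decide) _ _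
  · intro i
    rw [State.arr_setArr]
    have h5 : (s₄.arr Var.lens) = s.arr Var.lens := hF₄'.arr _ (by decide)
    change (if Var.lens = Var.lens ∧ i = s₄.reg Var.l + 1 then s₄.reg Var.r else
      s₄.arr Var.lens i) = _
    rw [h5, hr₄, hl₄]
    simp
  · intro β hβ
    have hw₂ : s₂.arr Var.work = s.arr Var.work := hF₂.arr _ (by decide)
    have hpad : ∀ u < 2 * 2 ^ z, ev y (2 ^ x) (s₃.arr Var.work)
        ((β * (2 * 2 ^ z) + u) * 2 ^ x) = if u < 2 ^ z then ∑ j ∈ range (2 ^ x),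
          (s.arr Var.work (β * (2 ^ z * 2 ^ x) + (u + 2 ^ z * j)) : S) * y ^ j else 0 := by
      intro u hu
      refine ev_pad (T := 2 * T) (B := B) (hT₃'.symm.trans hT₃) hβ hu fun I hI => ?_
      rw [hA₃ I (by rw [hT₂]; exact hI), evalNat_padExpr]
      change padVal (s₂.reg Var.m) (s₂.reg Var.r) (s₂.reg Var.c) (s₂.arr Var.work) I = _
      rw [hm₂, hr₂, hc₂, hw₂, hmr]
    refine ⟨fun i => ∑ j ∈ range (2 ^ x),
      (s.arr Var.work (β * (2 ^ z * 2 ^ x) + (i + 2 ^ z * j)) : S) * y ^ j, ?_, fun t ht => ?_⟩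
    · rw [← hmr]
      exact ev_mul hX _ _
    · change ev y (2 ^ x) (s₄.arr Var.work) _ = _
      rw [hA₄ β hβ t ht, two_mul (2 ^ z), sum_range_add]
      have h6 : ∀ u ∈ range (2 ^ z), y ^ (2 ^ (x - z) * t * (2 ^ z + u)) *
          ev y (2 ^ x) (s₃.arr Var.work) ((β * (2 ^ z + 2 ^ z) + (2 ^ z + u)) * 2 ^ x) = 0 := by
        intro u hu
        have hu := mem_range.1 hu
        rw [← two_mul (2 ^ z), hpad _ (by omega), if_neg (by omega), mul_zero]
      rw [sum_eq_zero h6, add_zero]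
      refine sum_congr rfl fun u hu => ?_
      have hu := mem_range.1 hu
      rw [← two_mul (2 ^ z), hpad _ (by omega), if_pos hu]

/-- `sum_fourier_mul` applied to blocks: the same transform is run again, and the reflection of
indices is built into the unpadding. The price is a factor 2m = 2^(E/2+1), which is kept. -/
theorem runs_backwardStep {w V : ℕ} (hV : Roomy w V) {s : State} (hs : s.Bounded V) {E B L : ℕ}
    (hE : 2 ≤ E) (hB : 0 < B) (hl : s.reg Var.l = L + 1) (hc : s.arr Var.lens L = 2 ^ E)
    (hr : s.arr Var.lens (L + 1) = 2 ^ ((E + 1) / 2)) (hT : s.reg Var.T = 2 * (B * 2 ^ E))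
    (h2 : 2 ≤ s.reg Var.M)
    {S : Type*} [CommRing S] (hM : (s.reg Var.M : S) = 0) {X y : S} (hX : X ^ 2 ^ (E / 2) = y)
    (hy : y ^ 2 ^ ((E + 1) / 2) = -1) :
    Runs w backwardStep s (500 * (E + 2) * (s.reg Var.T + 1)) fun s' =>
      s'.Bounded V ∧ Frame [Var.I, Var.q, Var.h, Var.r, Var.m, Var.T, Var.c, Var.l]
        [Var.work, Var.buf] s s' ∧ s'.reg Var.l = L ∧ s'.reg Var.T = B * 2 ^ E ∧
      ∀ β < B, ∀ (a b : ℕ → S) (κ : S), (∀ t < 2 * 2 ^ (E / 2),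
          ev y (2 ^ ((E + 1) / 2)) (s.arr Var.work)
            ((β * (2 * 2 ^ (E / 2)) + t) * 2 ^ ((E + 1) / 2)) = κ *
          (∑ i ∈ range (2 ^ (E / 2)), y ^ (2 ^ ((E + 1) / 2 - E / 2) * t * i) * a i) *
          ∑ i ∈ range (2 ^ (E / 2)), y ^ (2 ^ ((E + 1) / 2 - E / 2) * t * i) * b i) →
        ev X (2 ^ E) (s'.arr Var.work) (β * 2 ^ E) = 2 ^ (E / 2 + 1) * κ *
          (∑ i ∈ range (2 ^ (E / 2)), X ^ i * a i) *
          ∑ i ∈ range (2 ^ (E / 2)), X ^ i * b i := by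
  set x := (E + 1) / 2 with hx
  set z := E / 2 with hz
  have hmr : 2 ^ z * 2 ^ x = 2 ^ E := by rw [← pow_add]; congr 1; omega
  set T := s.reg Var.T with hTdef
  have hcost : unpadExpr.cost ≤ 200 := by decide
  have hcV : 2 ^ E ≤ V := hc ▸ hs.arr_le _ _
  have hrV : 2 ^ x ≤ V := hr ▸ hs.arr_le _ _
  have hzV : 2 ^ z ≤ V := (Nat.pow_le_pow_right (by norm_num) (by omega)).trans hcV
  have hLV : L + 1 ≤ V := hl ▸ hs.reg_le _
  set s₁ := s.setReg Var.r (2 ^ x) with hs₁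
  set s₂ := s₁.setReg Var.l L with hs₂
  set s₃ := s₂.setReg Var.c (2 ^ E) with hs₃
  set s₄ := s₃.setReg Var.m (2 ^ z) with hs₄
  have hb₁ : s₁.Bounded V := hs.setReg _ hrV
  have hb₂ : s₂.Bounded V := hb₁.setReg _ (by omega)
  have hb₃ : s₃.Bounded V := hb₂.setReg _ hcV
  have hb₄ : s₄.Bounded V := hb₃.setReg _ hzV
  have e1 : (Expr.load Var.lens (.reg Var.l)).evalNat s = 2 ^ x := by
    rw [evalNat_load, evalNat_reg, hl, hr]
  have e2 : (Expr.reg Var.l - .const 1).evalNat s₁ = L := by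
    change s.reg Var.l - 1 = L
    rw [hl, Nat.add_sub_cancel]
  have e3 : (Expr.load Var.lens (.reg Var.l)).evalNat s₂ = 2 ^ E := hc
  have e4 : (Expr.reg Var.c / .reg Var.r).evalNat s₃ = 2 ^ z := by
    change 2 ^ E / 2 ^ x = 2 ^ z
    rw [← hmr, Nat.mul_div_cancel _ (by positivity)]
  refine Runs.le (b := 3 + (4 + (3 + (4 + (300 * (z + 2) * (T + 1) + (4 + 222 * (T + 1)))))))
    (Runs.assignNat_seq hV hs (by decide) ?_) ?_
  swap
  · have h3 : 500 * (E + 2) * (T + 1) = 300 * (z + 2) * (T + 1) + 222 * (T + 1) +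
        (500 * E - 300 * z + 178) * (T + 1) := by
      have : 500 * (E + 2) = 300 * (z + 2) + 222 + (500 * E - 300 * z + 178) := by omega
      rw [this]; ring
    have h4 := Nat.le_mul_of_pos_right (500 * E - 300 * z + 178) (by omega : 0 < T + 1)
    omega
  rw [e1]
  refine Runs.assignNat_seq hV hb₁ (by decide) ?_
  rw [e2]
  refine Runs.assignNat_seq hV hb₂ (by decide) ?_
  rw [e3]
  refine Runs.assignNat_seq hV hb₃ (by decide) ?_
  rw [e4]
  have hF₄ : Frame [Var.r, Var.m, Var.c, Var.l] [] s s₄ :=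
    ((((Frame.refl _ _ s).setReg (by decide) _).setReg (by decide) _).setReg (by decide)
      _).setReg (by decide) _
  have hT₄ : s₄.reg Var.T = T := hF₄.reg _ (by decide)
  have hM₄ : s₄.reg Var.M = s.reg Var.M := hF₄.reg _ (by decide)
  have hdft := runs_dft hV hb₄ (x := x) (z := z) (by omega) hB rfl rfl
    (by rw [hT₄, hT, ← hmr]; ring) (hM₄ ▸ h2) (hM₄ ▸ hM) hy
  rw [hT₄] at hdft
  refine Runs.seq hdft ?_
  rintro s₅ ⟨hb₅, hF₅, hA₅⟩
  have hF₅' : Frame [Var.I, Var.q, Var.h, Var.r, Var.m, Var.c, Var.l] [Var.work, Var.buf] s s₅ :=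
    (hF₄.mono (by decide) (by decide)).trans (hF₅.mono (by decide) (by decide))
  have e5 : (Expr.reg Var.T / .const 2).evalNat s₅ = B * 2 ^ E := by
    change s₅.reg Var.T / 2 = _
    rw [hF₅'.reg _ (by decide), ← hTdef, hT, Nat.mul_div_cancel_left _ (by norm_num)]
  have hTV : B * 2 ^ E ≤ V := by
    have := hs.reg_le Var.T
    omega
  refine Runs.assignNat_seq hV hb₅ (by decide) ?_
  rw [e5]
  set s₆ := s₅.setReg Var.T (B * 2 ^ E) with hs₆
  have hb₆ : s₆.Bounded V := hb₅.setReg _ hTV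
  have hM₆ : s₆.reg Var.M = s.reg Var.M := hF₅'.reg _ (by decide)
  have hmap := runs_mapTo_frame (s := s₆) (d := Var.work) (E := unpadExpr) hV hb₆ (by decide)
    (by decide) (by decide) fun idx _ => by
      rw [evalNat_unpadExpr]
      refine (Nat.mod_lt _ ?_).le.trans (hb₆.reg_le Var.M)
      change 0 < s₆.reg Var.M
      omega
  have hT₆ : s₆.reg Var.T = B * 2 ^ E := rfl
  refine (hmap.mono (Nat.mul_le_mul (by omega) (by rw [hT₆, hT]; omega)) ?_)
  rintro s₇ ⟨hb₇, hF₇, hA₇⟩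
  refine ⟨hb₇, ?_, ?_, ?_, ?_⟩
  · exact ((hF₅'.mono (by decide) (by decide)).setReg (by decide) _).trans
      (hF₇.mono (by decide) (by decide))
  · rw [hF₇.reg _ (by decide)]
    exact hF₅.reg _ (by decide)
  · exact hF₇.reg _ (by decide)
  · intro β hβ a b κ hab
    have hun := ev_unpad (A := s₅.arr Var.work) (A' := s₇.arr Var.work) hM h2 hy (by positivity)
      hX (T := B * 2 ^ E) (B := B) (β := β) (by rw [← hmr]; ring) hβ ?_
    · rw [← hmr, hun]
      have hm0 : 0 < 2 ^ z := by positivity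
      refine sum_fourier_mul (z := z) rfl (ζ := y ^ 2 ^ (x - z)) ?_ hX a b
        (fun k => ev y (2 ^ x) (s₅.arr Var.work) ((β * (2 * 2 ^ z) + k) * 2 ^ x)) fun k hk => ?_
      · rw [← pow_mul, ← pow_add, show x - z + z = x by omega, hy]
      · rw [hA₅ β hβ k hk]
        refine sum_congr rfl fun t ht => ?_
        have hw₄ : s₄.arr Var.work = s.arr Var.work := rfl
        rw [hw₄, hab t (mem_range.1 ht)]
        simp only [← pow_mul, mul_assoc]
    · intro I hI
      rw [hA₇ I hI, evalNat_unpadExpr]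
      change unpadVal (s₆.reg Var.M) (s₅.reg Var.m) (s₅.reg Var.r) (s₅.arr Var.work) I = _
      rw [hM₆, hF₅.reg _ (by decide), hF₅.reg Var.r (by decide)]
      rfl

end WordRAM

namespace WordRAM

open Negacyclic Finset

/-! ### Negacyclic convolution -/

/-- The binary logarithms of the block lengths at the levels of the recursion. -/
def level (e : ℕ) : ℕ → ℕ
  | 0 => e
  | l + 1 => (level e l + 1) / 2

theorem level_le (e l : ℕ) : level e l ≤ e := by
  induction l with
  | zero => exact le_rfl
  | succ l ih => simp only [level]; omega

theorem one_le_level {e : ℕ} (he : 1 ≤ e) (l : ℕ) : 1 ≤ level e l := by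
  induction l with
  | zero => exact he
  | succ l ih => simp only [level]; omega

/-- Each step at least halves `level` minus one. Hence 2^l ≤ e as long as blocks are longer than
two, and this limits the growth of the data to a factor O(e). -/
theorem two_pow_mul_level_le (e l : ℕ) : 2 ^ l * (level e l - 1) ≤ e - 1 := by
  induction l with
  | zero => simp [level]
  | succ l ih =>
    refine le_trans ?_ ih
    rw [pow_succ, mul_assoc]
    refine Nat.mul_le_mul le_rfl ?_
    simp only [level]
    omega

theorem two_pow_le_of_two_le_level {e l : ℕ} (h : 2 ≤ level e l) : 2 ^ l ≤ e :=
  calc 2 ^ l ≤ 2 ^ l * (level e l - 1) := Nat.le_mul_of_pos_right _ (by omega)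
    _ ≤ e - 1 := two_pow_mul_level_le e l
    _ ≤ e := Nat.sub_le _ _

/-- The number of blocks of each of the two factors at level `l`. -/
def numBlocks (e l : ℕ) : ℕ := 2 ^ l * 2 ^ (e - level e l)

theorem numBlocks_mul (e l : ℕ) : numBlocks e l * 2 ^ level e l = 2 ^ l * 2 ^ e := by
  rw [numBlocks, mul_assoc, ← pow_add, Nat.sub_add_cancel (level_le e l)]

theorem numBlocks_pos (e l : ℕ) : 0 < numBlocks e l := by
  unfold numBlocks
  positivity

theorem numBlocks_succ (e l : ℕ) :
    numBlocks e (l + 1) = numBlocks e l * (2 * 2 ^ (level e l / 2)) := by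
  have h1 := level_le e l
  have h2 : e - (level e l + 1) / 2 = (e - level e l) + level e l / 2 := by omega
  simp only [numBlocks, level]
  rw [h2, pow_add, pow_succ]
  ring

section Point

variable {S : Type*} [CommRing S] (X : S) (e : ℕ)

/-- The point at which the blocks of level `l` are evaluated. -/
def point (l : ℕ) : S := X ^ 2 ^ (e - level e l)

/-- The inner variable of one level is the outer variable of the next, so one ring serves the whole
recursion. -/
theorem point_pow_half (l : ℕ) : point X e l ^ 2 ^ (level e l / 2) = point X e (l + 1) := by
  have h1 := level_le e l
  rw [point, point, ← pow_mul, ← pow_add]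
  congr 2
  simp only [level]
  omega

variable {X e} in
theorem point_pow (hX : X ^ 2 ^ e = -1) (l : ℕ) : point X e l ^ 2 ^ level e l = -1 := by
  rw [point, ← pow_mul, ← pow_add, Nat.sub_add_cancel (level_le e l), hX]

/-- The blocks `g` at level `l + 1` are the transforms of the blocks `f` at level `l`. -/
def Refines (l : ℕ) (f g : ℕ → S) : Prop :=
  ∀ β < 2 * numBlocks e l, ∃ a : ℕ → S,
    f β = ∑ i ∈ range (2 ^ (level e l / 2)), point X e l ^ i * a i ∧
    ∀ t < 2 * 2 ^ (level e l / 2), g (β * (2 * 2 ^ (level e l / 2)) + t) =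
      ∑ i ∈ range (2 ^ (level e l / 2)),
        point X e (l + 1) ^ (2 ^ ((level e l + 1) / 2 - level e l / 2) * t * i) * a i

end Point

def forward : Program := .loop (.op .lt (.const 2) (.reg Var.c)) forwardStep

def backward : Program := .loop (.reg Var.l) backwardStep

/-- Multiply two blocks of length `n`. -/
def convolve : Program :=
  .seq (.assign Var.c (.reg Var.n)) (.seq (.assign Var.l (.const 0))
    (.seq (.store Var.lens (.reg Var.l) (.reg Var.c)) (.seq forward
      (.seq (.assign Var.T (.reg Var.T / .const 2)) (.seq (mapTo Var.work baseExpr) backward)))))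

/-- The registers and arrays changed by `convolve`. -/
abbrev ConvFrame (s s' : State) : Prop :=
  Frame [Var.I, Var.q, Var.h, Var.r, Var.m, Var.T, Var.c, Var.l] [Var.work, Var.buf, Var.lens] s s'

variable {w V : ℕ} {s : State} {e : ℕ} {S : Type*} [CommRing S] {X : S}

/-- A state reached by the forward transform at level `L`, where the blocks have the values `F`. -/
structure ForwardState (V : ℕ) (s : State) (e : ℕ) (X : S) (L : ℕ) (F : ℕ → ℕ → S)
    (s' : State) : Prop where
  le : L + level e L ≤ e
  bounded : s'.Bounded V
  frame : ConvFrame s s'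
  reg_c : s'.reg Var.c = 2 ^ level e L
  reg_l : s'.reg Var.l = L
  reg_T : s'.reg Var.T = 2 ^ (L + 1) * 2 ^ e
  lens : ∀ l ≤ L, s'.arr Var.lens l = 2 ^ level e l
  blocks : ∀ β < 2 * numBlocks e L,
    ev (point X e L) (2 ^ level e L) (s'.arr Var.work) (β * 2 ^ level e L) = F L β
  refines : ∀ l < L, 2 ≤ level e l ∧ Refines X e l (F l) (F (l + 1))
  zero : ∀ β, F 0 β = ev X (2 ^ e) (s.arr Var.work) (β * 2 ^ e)

/-- The block length drops at every step, so e steps certainly suffice. While a step is possible 2^L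
≤ e, so even after doubling the array has at most 4e · 2^e cells. -/
theorem runs_forward (hV : Roomy w V) (he : 2 ≤ e) (hVe : 4 * e * 2 ^ e ≤ V)
    (h2 : 2 ≤ s.reg Var.M) (hM : (s.reg Var.M : S) = 0) (hX : X ^ 2 ^ e = -1) {F : ℕ → ℕ → S}
    {s₀ : State} (hs₀ : ForwardState V s e X 0 F s₀) :
    Runs w forward s₀ (e * (500 * (e + 2) * (4 * e * 2 ^ e + 1) + 4) + 4)
      fun s' => ∃ L F, level e L = 1 ∧ ForwardState V s e X L F s' := by
  set K := 500 * (e + 2) * (4 * e * 2 ^ e + 1) with hK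
  refine Runs.mono (Runs.loop (fun g : ℕ × (ℕ → ℕ → S) => ForwardState V s e X g.1 g.2)
    (fun g => (level e g.1) * (K + 4)) ?_ (0, F) hs₀) ?_ ?_
  · rintro ⟨L, F⟩ s' h hne
    dsimp only at h ⊢
    have hE : 2 ≤ level e L := by
      by_contra hlt
      refine hne ((Expr.eval_lt_eq_zero hV h.bounded _ _ (by decide)).2 ?_)
      rw [evalNat_reg, h.reg_c]
      exact Nat.pow_le_pow_right (n := 2) (by norm_num) (by omega : level e L ≤ 1)
    have hL := two_pow_le_of_two_le_level hE
    have hTe : 2 * s'.reg Var.T ≤ 4 * e * 2 ^ e := by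
      rw [h.reg_T, pow_succ]
      calc 2 * (2 ^ L * 2 * 2 ^ e) = 4 * 2 ^ L * 2 ^ e := by ring
        _ ≤ 4 * e * 2 ^ e := by gcongr
    have hT : s'.reg Var.T = 2 * numBlocks e L * 2 ^ level e L := by
      rw [h.reg_T, mul_assoc, numBlocks_mul, pow_succ]; ring
    have hM' : s'.reg Var.M = s.reg Var.M := h.frame.reg _ (by decide)
    have hl : s'.reg Var.l + 1 ≤ V := by
      rw [h.reg_l]
      have := h.le
      have h3 : e * 1 ≤ 4 * e * 2 ^ e := Nat.mul_le_mul (by omega) Nat.one_le_two_pow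
      omega
    have hstep := runs_forwardStep (X := point X e L) (y := point X e (L + 1)) hV h.bounded hE
      (Nat.mul_pos two_pos (numBlocks_pos e L)) h.reg_c hT (hTe.trans hVe) hl (hM' ▸ h2)
      (hM' ▸ hM) (point_pow_half X e L) (point_pow hX (L + 1))
    refine ⟨K, hstep.mono ?_ ?_⟩
    · have := level_le e L
      exact Nat.mul_le_mul (by omega) (by omega)
    · rintro s'' ⟨hb, hF, hc, hl', hT', hlens, hblocks⟩
      -- The values at every level are kept as ghost data: the cells are overwritten, but the way
      -- back needs the relation between consecutive levels.
      set G := Function.update F (L + 1) fun β =>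
        ev (point X e (L + 1)) (2 ^ level e (L + 1)) (s''.arr Var.work)
          (β * 2 ^ level e (L + 1)) with hG
      have hG1 : G (L + 1) = fun β => ev (point X e (L + 1)) (2 ^ level e (L + 1))
        (s''.arr Var.work) (β * 2 ^ level e (L + 1)) := Function.update_self ..
      have hG2 : ∀ l ≤ L, G l = F l := fun l hl => Function.update_of_ne (by omega) _ _
      have hdec : level e (L + 1) + 1 ≤ level e L := by simp only [level]; omega
      refine ⟨(L + 1, G), (⟨?_, hb, h.frame.trans hF, hc, ?_, ?_, ?_, ?_, ?_, ?_⟩ :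
        ForwardState V s e X (L + 1) G s''), ?_⟩
      · have := h.le
        omega
      · rw [hl', h.reg_l]
      · rw [hT', h.reg_T, pow_succ]; ring
      · intro l hl
        rw [hlens, h.reg_l]
        split_ifs with h3
        · rw [h3]; rfl
        · exact h.lens l (by omega)
      · intro β _
        exact (congrFun hG1 β).symm
      · intro l hl
        rcases Nat.lt_succ_iff_lt_or_eq.1 hl with h3 | rfl
        · rw [hG2 l h3.le, hG2 (l + 1) h3]
          exact h.refines l h3
        · refine ⟨hE, fun β hβ => ?_⟩
          obtain ⟨a, ha1, ha2⟩ := hblocks β hβ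
          rw [hG1, hG2 l le_rfl, ← h.blocks β hβ]
          exact ⟨a, ha1, ha2⟩
      · intro β
        rw [hG2 0 (Nat.zero_le _)]
        exact h.zero β
      · have h5 : (level e (L + 1) + 1) * (K + 4) ≤ level e L * (K + 4) :=
          Nat.mul_le_mul hdec le_rfl
        have h6 : (Expr.op .lt (.const 2) (.reg Var.c)).cost = 3 := rfl
        rw [h6]
        rw [Nat.add_mul] at h5
        dsimp only
        omega
  · simp only [level, Expr.cost]
    omega
  · rintro s' ⟨⟨L, F⟩, h, h0⟩
    refine ⟨L, F, ?_, h⟩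
    rw [Expr.eval_lt_eq_zero hV h.bounded _ _ (by decide), evalNat_reg, h.reg_c] at h0
    have h1 := one_le_level (by omega : 1 ≤ e) L
    have h3 : level e L ≤ 1 := (Nat.pow_le_pow_iff_right (a := 2) (by norm_num)).1 h0
    omega

/-- A state reached by the backward transform at level `l`. -/
structure BackwardState (V : ℕ) (s : State) (e : ℕ) (X : S) (L : ℕ) (F : ℕ → ℕ → S) (l : ℕ)
    (s' : State) : Prop where
  le : l ≤ L
  bounded : s'.Bounded V
  frame : ConvFrame s s'
  reg_l : s'.reg Var.l = l
  reg_T : s'.reg Var.T = 2 ^ l * 2 ^ e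
  lens : ∀ l ≤ L, s'.arr Var.lens l = 2 ^ level e l
  blocks : ∃ κ : ℕ, ∀ β < numBlocks e l,
    ev (point X e l) (2 ^ level e l) (s'.arr Var.work) (β * 2 ^ level e l) =
      2 ^ κ * F l β * F l (β + numBlocks e l)

/-- The recorded relations supply the a_i and b_i of the paired blocks β and β + `numBlocks`, one
from each factor. Each level turns pointwise products of transforms into products of blocks and
raises the power of two. -/
theorem runs_backward (hV : Roomy w V) (h2 : 2 ≤ s.reg Var.M) (hM : (s.reg Var.M : S) = 0)
    (hX : X ^ 2 ^ e = -1) {L : ℕ} {F : ℕ → ℕ → S}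
    (href : ∀ l < L, 2 ≤ level e l ∧ Refines X e l (F l) (F (l + 1)))
    {s₀ : State} (hs₀ : BackwardState V s e X L F L s₀) :
    Runs w backward s₀ (L * (500 * (e + 2) * (4 * e * 2 ^ e + 1) + 4) + 2)
      (BackwardState V s e X L F 0) := by
  set K := 500 * (e + 2) * (4 * e * 2 ^ e + 1) with hK
  refine Runs.mono (Runs.loop (fun l : ℕ => BackwardState V s e X L F l)
    (fun l => l * (K + 4)) ?_ L hs₀) le_rfl ?_
  · intro l' s' h hne
    obtain ⟨l, rfl⟩ : ∃ l, l' = l + 1 := by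
      refine ⟨l' - 1, ?_⟩
      have h3 : s'.reg Var.l ≠ 0 := hne
      rw [h.reg_l] at h3
      omega
    have hle := h.le
    obtain ⟨hE, hR⟩ := href l hle
    have hL := two_pow_le_of_two_le_level hE
    have hM' : s'.reg Var.M = s.reg Var.M := h.frame.reg _ (by decide)
    have hstep := runs_backwardStep (X := point X e l) (y := point X e (l + 1)) hV h.bounded hE
      (numBlocks_pos e l) h.reg_l (h.lens l (by omega)) (h.lens (l + 1) hle)
      (by rw [h.reg_T, numBlocks_mul, pow_succ]; ring) (hM' ▸ h2)
      (hM' ▸ hM) (point_pow_half X e l) (point_pow hX (l + 1))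
    refine ⟨K, hstep.mono ?_ ?_⟩
    · have := level_le e l
      refine Nat.mul_le_mul (by omega) ?_
      rw [h.reg_T, pow_succ]
      have : 2 ^ l * 2 * 2 ^ e ≤ 4 * e * 2 ^ e := Nat.mul_le_mul (by omega) le_rfl
      omega
    · rintro s'' ⟨hb, hF, hl', hT', hblocks⟩
      refine ⟨l, ⟨by omega, hb, h.frame.trans (hF.mono (by decide) (by decide)), hl', ?_, ?_, ?_⟩,
        ?_⟩
      · rw [hT', numBlocks_mul]
      · rw [hF.arr _ (by decide)]
        exact h.lens
      · obtain ⟨κ, hκ⟩ := h.blocks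
        refine ⟨level e l / 2 + 1 + κ, fun β hβ => ?_⟩
        obtain ⟨a, ha1, ha2⟩ := hR β (by omega)
        obtain ⟨b, hb1, hb2⟩ := hR (β + numBlocks e l) (by omega)
        have h4 := hblocks β hβ a b (2 ^ κ) fun t ht => ?_
        · rw [h4, ← ha1, ← hb1, pow_add _ (_ + 1) κ]
        rw [← ha2 t ht, ← hb2 t ht]
        have h3 := hκ (β * (2 * 2 ^ (level e l / 2)) + t)
          (block_lt (numBlocks_succ e l) hβ ht)
        rw [numBlocks_succ] at h3
        rw [show (β + numBlocks e l) * (2 * 2 ^ (level e l / 2)) + t =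
          β * (2 * 2 ^ (level e l / 2)) + t + numBlocks e l * (2 * 2 ^ (level e l / 2)) by ring]
        exact h3
      · have h6 : (Expr.reg Var.l).cost = 1 := rfl
        rw [h6, Nat.add_mul]
        omega
  · rintro s' ⟨l, h, h0⟩
    have h3 : s'.reg Var.l = 0 := h0
    rw [h.reg_l] at h3
    exact h3 ▸ h

theorem runs_convolve (hV : Roomy w V) (hs : s.Bounded V) (he : 2 ≤ e)
    (hVe : 4 * e * 2 ^ e ≤ V) (hn : s.reg Var.n = 2 ^ e) (hT : s.reg Var.T = 2 * 2 ^ e)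
    (h2 : 2 ≤ s.reg Var.M) (hM : (s.reg Var.M : S) = 0) (hX : X ^ 2 ^ e = -1) :
    Runs w convolve s (2000 * (e + 2) ^ 2 * (4 * e * 2 ^ e + 1)) fun s' =>
      s'.Bounded V ∧ ConvFrame s s' ∧ ∃ κ : ℕ, ev X (2 ^ e) (s'.arr Var.work) 0 =
        2 ^ κ * ev X (2 ^ e) (s.arr Var.work) 0 * ev X (2 ^ e) (s.arr Var.work) (2 ^ e) := by
  set U := 4 * e * 2 ^ e + 1 with hU
  set K := 500 * (e + 2) * U with hK
  have hb₁ : (s.setReg Var.c (2 ^ e)).Bounded V := hs.setReg _ (hn ▸ hs.reg_le _)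
  have hb₂ : ((s.setReg Var.c (2 ^ e)).setReg Var.l 0).Bounded V := hb₁.setReg _ (Nat.zero_le _)
  set s₃ := ((s.setReg Var.c (2 ^ e)).setReg Var.l 0).setArr Var.lens 0 (2 ^ e) with hs₃
  have hb₃ : s₃.Bounded V := hb₂.setArr _ _ (hn ▸ hs.reg_le _)
  have hF₃ : ConvFrame s s₃ :=
    (((Frame.refl _ _ s).setReg (by decide) _).setReg (by decide) _).setArr (by decide) _ _
  have hstart : ForwardState V s e X 0
      (fun _ β => ev X (2 ^ e) (s.arr Var.work) (β * 2 ^ e)) s₃ := by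
    refine ⟨by simp [level], hb₃, hF₃, rfl, rfl, ?_, ?_, ?_, by simp, by simp⟩
    · rw [show s₃.reg Var.T = s.reg Var.T from rfl, hT, zero_add, pow_one]
    · intro l hl
      obtain rfl : l = 0 := by omega
      rfl
    · intro β _
      have h3 : point X e 0 = X := by simp [point, level]
      rw [h3]
      rfl
  have hfwd := runs_forward hV he hVe h2 hM hX hstart
  have hcost : baseExpr.cost ≤ 200 := by decide
  refine Runs.le (b := 2 + (2 + (3 + ((e * (K + 4) + 4) + (4 + (222 * U + (e * (K + 4) + 2)))))))
    (Runs.assignNat_seq hV hs (by decide) ?_) ?_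
  swap
  · have h3 : 2000 * (e + 2) ^ 2 * U = 2 * (e * K) + (1000 * (e + 2) * e + 4000 * (e + 2)) * U := by
      rw [hK]; ring
    have h4 : (8 * e + 222 + 100) * U ≤ (1000 * (e + 2) * e + 4000 * (e + 2)) * U :=
      by
      refine Nat.mul_le_mul ?_ le_rfl
      have : 8 * e ≤ 1000 * (e + 2) * e := Nat.mul_le_mul (by omega) le_rfl
      omega
    have h5 := Nat.le_mul_of_pos_right (8 * e + 100) (by omega : 0 < U)
    have h6 : (8 * e + 222 + 100) * U = 222 * U + (8 * e + 100) * U := by ring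
    have h7 : e * (K + 4) = e * K + 4 * e := by ring
    omega
  rw [show (Expr.reg Var.n).evalNat s = 2 ^ e from hn]
  refine Runs.assignNat_seq hV hb₁ (by decide) (Runs.seq (Q := fun s' => s' = s₃)
    (Runs.storeNat hV hb₂ (by decide) (by decide) rfl) ?_)
  rintro _ rfl
  refine Runs.seq hfwd ?_
  rintro s₄ ⟨L, F, hL1, h₄⟩
  have h1 := numBlocks_mul e L
  rw [hL1, pow_one] at h1
  have e5 : (Expr.reg Var.T / .const 2).evalNat s₄ = 2 ^ L * 2 ^ e := by
    change s₄.reg Var.T / 2 = _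
    rw [h₄.reg_T, show 2 ^ (L + 1) * 2 ^ e = 2 * (2 ^ L * 2 ^ e) by ring,
      Nat.mul_div_cancel_left _ (by norm_num)]
  have hTV : 2 ^ L * 2 ^ e ≤ V := by
    have := h₄.bounded.reg_le Var.T
    rw [h₄.reg_T, pow_succ] at this
    nlinarith
  refine Runs.assignNat_seq hV h₄.bounded (by decide) ?_
  rw [e5]
  set s₅ := s₄.setReg Var.T (2 ^ L * 2 ^ e) with hs₅
  have hb₅ : s₅.Bounded V := h₄.bounded.setReg _ hTV
  have hF₅ : ConvFrame s s₅ := h₄.frame.setReg (by decide) _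
  have hM₅ : s₅.reg Var.M = s.reg Var.M := hF₅.reg _ (by decide)
  have hmap := runs_mapTo_frame (s := s₅) (d := Var.work) (E := baseExpr) hV hb₅ (by decide)
    (by decide) (by decide) fun idx _ => by
      rw [evalNat_baseExpr]
      refine (Nat.mod_lt _ ?_).le.trans (hb₅.reg_le Var.M)
      change 0 < s₅.reg Var.M
      omega
  have hT₅ : s₅.reg Var.T = 2 ^ L * 2 ^ e := rfl
  have hLe : L ≤ e := (Nat.le_add_right _ _).trans h₄.le
  -- The last forward step started from blocks longer than two, so 2^(L-1) ≤ e.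
  have hLU : 2 ^ L * 2 ^ e + 1 ≤ U := by
    rw [hU]
    refine Nat.succ_le_succ (Nat.mul_le_mul ?_ le_rfl)
    rcases L with _ | L
    · simp; omega
    · have := two_pow_le_of_two_le_level (h₄.refines L (Nat.lt_succ_self L)).1
      rw [pow_succ]
      omega
  refine Runs.seq (hmap.le (Nat.mul_le_mul (by omega) (by rw [hT₅]; exact hLU))) ?_
  rintro s₆ ⟨hb₆, hF₆, hA₆⟩
  have hback : BackwardState V s e X L F L s₆ := by
    refine ⟨le_rfl, hb₆, hF₅.trans (hF₆.mono (by decide) (by decide)), ?_, ?_, ?_, 0, ?_⟩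
    · rw [hF₆.reg _ (by decide)]; exact h₄.reg_l
    · exact hF₆.reg _ (by decide)
    · rw [hF₆.arr _ (by decide)]; exact h₄.lens
    · intro β hβ
      have hy := point_pow hX L
      have hbl₁ := h₄.blocks β (by omega)
      have hbl₂ := h₄.blocks (β + numBlocks e L) (by omega)
      rw [hL1, pow_one] at hy hbl₁ hbl₂
      rw [hL1, pow_one, pow_zero, one_mul, ← hbl₁, ← hbl₂,
        ev_base (T := 2 ^ L * 2 ^ e) (A := s₄.arr Var.work) hM h2 hy (by omega) ?_]
      · rw [← h1, add_mul, add_comm]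
      · intro I hI
        rw [hA₆ I hI, evalNat_baseExpr, ← hM₅]
        rfl
  refine (runs_backward hV h2 hM hX h₄.refines hback).mono
    (Nat.add_le_add_right (Nat.mul_le_mul hLe le_rfl) _) ?_
  intro s₇ h₇
  refine ⟨h₇.bounded, h₇.frame, ?_⟩
  obtain ⟨κ, hκ⟩ := h₇.blocks
  refine ⟨κ, ?_⟩
  have h3 := hκ 0 (numBlocks_pos e 0)
  rw [h₄.zero, h₄.zero] at h3
  simpa [point, level, numBlocks] using h3

end WordRAM

namespace Negacyclic

open Finset Polynomial

/-! ### Coefficients recovered from values modulo X^n + 1. -/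

theorem monic_X_pow_add_one {R : Type*} [CommRing R] {n : ℕ} (hn : n ≠ 0) :
    (X ^ n + 1 : R[X]).Monic := by
  simpa using monic_X_pow_add_C (1 : R) hn

theorem root_pow_eq_neg_one (R : Type*) [CommRing R] (n : ℕ) :
    AdjoinRoot.root (X ^ n + 1 : R[X]) ^ n = -1 := by
  have h : AdjoinRoot.mk (X ^ n + 1 : R[X]) (X ^ n + 1) = 0 := AdjoinRoot.mk_self
  simp only [map_add, map_pow, AdjoinRoot.mk_X, map_one] at h
  exact eq_neg_of_add_eq_zero_left h

/-- The polynomial whose coefficients are stored in the block of length `n` at address `o`. -/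
noncomputable def blockPoly (R : Type*) [CommRing R] (n : ℕ) (A : ℕ → ℕ) (o : ℕ) : R[X] :=
  ∑ j ∈ range n, C (A (o + j) : R) * X ^ j

theorem coeff_blockPoly (R : Type*) [CommRing R] (n : ℕ) (A : ℕ → ℕ) (o k : ℕ) :
    (blockPoly R n A o).coeff k = if k < n then (A (o + k) : R) else 0 := by
  simp only [blockPoly, finsetSum_coeff, coeff_C_mul, coeff_X_pow, mul_ite, mul_one, mul_zero,
    sum_ite_eq, mem_range]

theorem mk_blockPoly (R : Type*) [CommRing R] (n : ℕ) (A : ℕ → ℕ) (o : ℕ) (g : R[X]) :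
    AdjoinRoot.mk g (blockPoly R n A o) = ev (AdjoinRoot.root g) n A o := by
  simp only [blockPoly, ev, map_sum, map_mul, map_pow, AdjoinRoot.mk_X, map_natCast]

/-- A negacyclic product of short polynomials is an ordinary product. -/
theorem coeff_of_ev_mul {R : Type*} [CommRing R] [Nontrivial R] {n N : ℕ} (hn : 2 * N < n)
    {A A' : ℕ → ℕ} (h0 : ∀ i, N < i → i < n → A i = 0 ∧ A (n + i) = 0) {κ : ℕ}
    (h : ev (AdjoinRoot.root (X ^ n + 1 : R[X])) n A' 0 =
      2 ^ κ * ev (AdjoinRoot.root (X ^ n + 1 : R[X])) n A 0 *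
        ev (AdjoinRoot.root (X ^ n + 1 : R[X])) n A n) {k : ℕ} (hk : k < n) :
    (A' k : R) = 2 ^ κ * ∑ p ∈ antidiagonal k, (A p.1 : R) * A (n + p.2) := by
  have hmonic := monic_X_pow_add_one (R := R) (by omega : n ≠ 0)
  set g : R[X] := X ^ n + 1 with hg
  have hmul : ∀ k, (C (2 ^ κ : R) * (blockPoly R n A 0 * blockPoly R n A n)).coeff k =
      2 ^ κ * ∑ p ∈ antidiagonal k, if p.1 < n ∧ p.2 < n then (A p.1 : R) * A (n + p.2) else 0 := by
    intro k
    rw [coeff_C_mul, coeff_mul]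
    congr 1
    refine sum_congr rfl fun p _ => ?_
    rw [coeff_blockPoly, coeff_blockPoly, zero_add]
    by_cases h1 : p.1 < n <;> by_cases h2 : p.2 < n <;> simp [h1, h2]
  have hdvd : g ∣ blockPoly R n A' 0 - C (2 ^ κ : R) * (blockPoly R n A 0 * blockPoly R n A n) := by
    rw [← AdjoinRoot.mk_eq_mk, map_mul, map_mul, mk_blockPoly, mk_blockPoly, mk_blockPoly, h]
    simp only [map_pow, map_ofNat, mul_assoc]
  -- Both factors have degree at most N and 2N < n, so the negacyclic reduction never acts. A
  -- multiple of the monic X^n + 1 of smaller degree is zero.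
  have hdeg : (blockPoly R n A' 0 - C (2 ^ κ : R) *
      (blockPoly R n A 0 * blockPoly R n A n)).degree < g.degree := by
    have h3 : g.degree = n := by
      rw [hg, ← C_1, degree_X_pow_add_C (by omega)]
    rw [h3, degree_lt_iff_coeff_zero]
    intro m hm
    rw [coeff_sub, hmul, coeff_blockPoly, if_neg (by omega), sum_eq_zero, mul_zero, sub_zero]
    intro p hp
    have hp := mem_antidiagonal.1 hp
    split_ifs with h4
    · rcases Nat.lt_or_ge N p.1 with h5 | h5
      · rw [(h0 p.1 h5 h4.1).1]; simp
      · rw [(h0 p.2 (by omega) h4.2).2]; simp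
    · rfl
  have hzero : blockPoly R n A' 0 - C (2 ^ κ : R) * (blockPoly R n A 0 * blockPoly R n A n) = 0 := by
    by_contra hne
    exact hmonic.not_dvd_of_degree_lt hne hdeg hdvd
  have hcoeff := congrArg (fun f => coeff f k) (sub_eq_zero.1 hzero)
  simp only [hmul, coeff_blockPoly, if_pos hk, zero_add] at hcoeff
  rw [hcoeff]
  congr 1
  refine sum_congr rfl fun p hp => ?_
  have hp := mem_antidiagonal.1 hp
  rw [if_pos ⟨by omega, by omega⟩]

/-- The product of two short polynomials with coefficients in `{0, 1}` modulo an odd number. -/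
theorem mod_pos_iff {n N M : ℕ} (hn : 2 * N < n) (hM : M = 2 * N + 1) (hN : 1 ≤ N)
    {A A' : ℕ → ℕ} (h0 : ∀ i, N < i → i < n → A i = 0 ∧ A (n + i) = 0) (h1 : ∀ i < 2 * n, A i ≤ 1) {κ : ℕ}
    (h : ev (AdjoinRoot.root (X ^ n + 1 : (ZMod M)[X])) n A' 0 =
      2 ^ κ * ev (AdjoinRoot.root (X ^ n + 1 : (ZMod M)[X])) n A 0 *
        ev (AdjoinRoot.root (X ^ n + 1 : (ZMod M)[X])) n A n) {k : ℕ} (hk : k ≤ N) :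
    0 < A' k % M ↔ ∃ i j, i + j = k ∧ A i = 1 ∧ A (n + j) = 1 := by
  have : Fact (1 < M) := ⟨by omega⟩
  have hcoeff := coeff_of_ev_mul hn h0 h (by omega : k < n)
  set c := ∑ p ∈ antidiagonal k, A p.1 * A (n + p.2) with hc
  -- The coefficient counts at most k + 1 ≤ N + 1 pairs, which is below 2N + 1 because N ≥ 1.
  have hcM : c < M := by
    have : c ≤ (antidiagonal k).card • 1 := by
      refine sum_le_card_nsmul _ _ _ fun p hp => ?_
      have hp := mem_antidiagonal.1 hp
      exact Nat.mul_le_mul (h1 _ (by omega)) (h1 _ (by omega))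
    rw [Nat.card_antidiagonal, smul_eq_mul, mul_one] at this
    omega
  -- This is why the modulus is odd: the leftover power of two is a unit and cannot affect
  -- vanishing.
  have hunit : IsUnit ((2 : ZMod M) ^ κ) := by
    refine IsUnit.pow _ ?_
    have h2 : IsUnit ((2 : ℕ) : ZMod M) := by
      rw [ZMod.isUnit_iff_coprime, hM]
      simp
    simpa using h2
  have hiff : 0 < A' k % M ↔ 0 < c := by
    rw [Nat.pos_iff_ne_zero, Nat.pos_iff_ne_zero, not_iff_not, ← Nat.dvd_iff_mod_eq_zero,
      ← ZMod.natCast_eq_zero_iff, hcoeff, hunit.mul_right_eq_zero]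
    have : (∑ p ∈ antidiagonal k, (A p.1 : ZMod M) * A (n + p.2)) = (c : ZMod M) := by
      rw [hc]; push_cast; rfl
    rw [this, ZMod.natCast_eq_zero_iff]
    exact ⟨fun h => Nat.eq_zero_of_dvd_of_lt h hcM, fun h => h ▸ dvd_zero _⟩
  rw [hiff, hc]
  constructor
  · intro hpos
    obtain ⟨p, hp, hne⟩ := exists_ne_zero_of_sum_ne_zero hpos.ne'
    have hp' := mem_antidiagonal.1 hp
    have ha := h1 p.1 (by omega)
    have hb := h1 (n + p.2) (by omega)
    refine ⟨p.1, p.2, hp', ?_, ?_⟩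
    · have : A p.1 ≠ 0 := left_ne_zero_of_mul hne
      omega
    · have : A (n + p.2) ≠ 0 := right_ne_zero_of_mul hne
      omega
  · rintro ⟨i, j, hij, hi, hj⟩
    refine lt_of_lt_of_le (by simp [hi, hj] : 0 < A i * A (n + j))
      (single_le_sum (f := fun p : ℕ × ℕ => A p.1 * A (n + p.2)) (fun _ _ => Nat.zero_le _)
        (mem_antidiagonal.2 hij : (i, j) ∈ antidiagonal k))

end Negacyclic

namespace WordRAM

open Negacyclic Finset

/-! ### Partial tables of integer complexities -/

/-- The table `o` contains only correct entries, for arguments at most `N` of complexity at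
most `k`, and it contains all those of complexity less than `k`. -/
structure PartialTable (N k : ℕ) (o : ℕ → ℕ) : Prop where
  sound : ∀ x, o x ≠ 0 → 1 ≤ x ∧ x ≤ N ∧ o x = integerComplexity x ∧ integerComplexity x ≤ k
  complete : ∀ x, 1 ≤ x → x ≤ N → integerComplexity x < k → o x = integerComplexity x

namespace PartialTable

variable {N k : ℕ} {o o' : ℕ → ℕ}

theorem le (h : PartialTable N k o) (x : ℕ) : o x ≤ k := by
  by_cases h0 : o x = 0
  · omega
  · have := h.sound x h0
    omega

/-- Entries of complexity `k` may be added. -/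
theorem extend (h : PartialTable N k o)
    (h' : ∀ x, o' x = o x ∨
      o x = 0 ∧ o' x = k ∧ 1 ≤ x ∧ x ≤ N ∧ integerComplexity x ≤ k) : PartialTable N k o' := by
  constructor
  · intro x hx
    rcases h' x with h1 | ⟨h1, h2, h3, h4, h5⟩
    · rw [h1] at hx ⊢
      exact h.sound x hx
    · refine ⟨h3, h4, ?_, h5⟩
      -- A complexity below k is impossible: by completeness the entry would already be present,
      -- whereas it is 0.
      rcases h5.lt_or_eq with h6 | h6
      · have := h.complete x h3 h4 h6
        have := one_le_integerComplexity h3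
        omega
      · omega
  · intro x hx1 hx2 hx3
    have h0 := h.complete x hx1 hx2 hx3
    have := one_le_integerComplexity hx1
    rcases h' x with h1 | ⟨h1, -⟩ <;> omega

theorem eq_iff (h : PartialTable N k o) {i : ℕ} (hi : 1 ≤ i) (hik : i < k) (x : ℕ) :
    o x = i ↔ 1 ≤ x ∧ x ≤ N ∧ integerComplexity x = i := by
  constructor
  · intro hx
    have := h.sound x (by omega)
    omega
  · rintro ⟨h1, h2, h3⟩
    rw [h.complete x h1 h2 (by omega), h3]

/-- An integer of complexity k ≥ 2 is greater than 1, so its optimal expression ends in a sum or a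
product, and one of the two hypotheses applies. Soundness makes a nonzero entry correct. -/
theorem succ (h : PartialTable N k o) (hk : 2 ≤ k)
    (hadd : ∀ a b, 1 ≤ a → 1 ≤ b → a + b ≤ N →
      integerComplexity a + integerComplexity b = k → o (a + b) ≠ 0)
    (hmul : ∀ a b, 1 ≤ a → 1 ≤ b → a * b ≤ N →
      integerComplexity a + integerComplexity b = k → o (a * b) ≠ 0) :
    PartialTable N (k + 1) o := by
  constructor
  · intro x hx
    have := h.sound x hx
    omega
  · intro x hx1 hx2 hx3
    rcases Nat.lt_succ_iff_lt_or_eq.1 hx3 with h1 | h1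
    · exact h.complete x hx1 hx2 h1
    have hx : 2 ≤ x := by
      by_contra hlt
      obtain rfl : x = 1 := by omega
      rw [integerComplexity_one] at h1
      omega
    obtain ⟨a, b, ha, hb, hab, hf⟩ := exists_integerComplexity_add_eq hx
    have hne : o x ≠ 0 := by
      rcases hab with rfl | rfl
      · exact hadd a b ha hb hx2 (hf.trans h1)
      · exact hmul a b ha hb hx2 (hf.trans h1)
    exact (h.sound x hne).2.2.1

theorem start (hN : 1 ≤ N) : PartialTable N 2 (Function.update (fun _ => 0) 1 1) := by
  constructor
  · intro x hx
    have h1 : x = 1 := by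
      by_contra h
      exact hx (Function.update_of_ne h _ _)
    subst h1
    simp [integerComplexity_one, hN]
  · intro x hx1 hx2 hx3
    have h1 : x = 1 := by
      by_contra h
      obtain ⟨a, b, ha, hb, -, hf⟩ := exists_integerComplexity_add_eq (by omega : 2 ≤ x)
      have := one_le_integerComplexity ha
      have := one_le_integerComplexity hb
      omega
    subst h1
    simp [integerComplexity_one]

end PartialTable

/-! ### Sums -/

/-- Mark the integers of complexity `i` in the first block, those of complexity `k - i` in the
second. -/
def loadExpr : Expr :=
  let first := Expr.op .lt (.reg Var.I) (.reg Var.n)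
  .op .eq (.load Var.out (.reg Var.I % .reg Var.n))
    (first * .reg Var.i + (.const 1 - first) * (.reg Var.k - .reg Var.i))

/-- Enter the sums that have not been found before. -/
def mergeExpr : Expr :=
  .load Var.out (.reg Var.I) + .op .eq (.load Var.out (.reg Var.I)) (.const 0) *
    .op .lt (.const 0) (.load Var.work (.reg Var.I) % .reg Var.M) * .reg Var.k

def addStep : Program :=
  .seq (.assign Var.T (.const 2 * .reg Var.n)) (.seq (mapTo Var.work loadExpr) (.seq convolve
    (.seq (.assign Var.T (.reg Var.N + .const 1)) (.seq (mapTo Var.out mergeExpr)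
      (.assign Var.i (.reg Var.i + .const 1))))))

def addLoop : Program :=
  .seq (.assign Var.i (.const 1)) (.loop (.op .lt (.reg Var.i) (.reg Var.k)) addStep)

/-- The word length is sufficient for the computations with input `N` and block length `2 ^ e`. -/
structure Params (w V N e : ℕ) : Prop where
  roomy : Roomy w V
  one_le : 1 ≤ N
  two_le : 2 ≤ e
  lt : 2 * N < 2 ^ e
  le : 4 * e * 2 ^ e ≤ V

/-- The memory contains the parameters, the current complexity `k`, and a partial table. -/
structure TableState (V N e k : ℕ) (s : State) : Prop where
  bounded : s.Bounded V
  reg_N : s.reg Var.N = N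
  reg_M : s.reg Var.M = 2 * N + 1
  reg_n : s.reg Var.n = 2 ^ e
  reg_e : s.reg Var.e = e
  reg_k : s.reg Var.k = k
  table : PartialTable N k (s.arr Var.out)

variable {w V N e k : ℕ} {s : State}

theorem Params.two_mul_lt (h : Params w V N e) : 2 * 2 ^ e ≤ V := by
  have h1 := h.two_le
  have h2 := h.le
  have h3 : 2 * 2 ^ e ≤ 4 * e * 2 ^ e := Nat.mul_le_mul (by omega) le_rfl
  omega

/-- Both i and k - i lie strictly between 0 and k, so these level sets are completely known, and
entries k added earlier do not disturb them. Every sum found has complexity at most k by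
subadditivity. -/
theorem runs_addStep (hp : Params w V N e) {i : ℕ} (hs : TableState V N e k s)
    (hi : s.reg Var.i = i) (hi1 : 1 ≤ i) (hik : i < k) :
    Runs w addStep s (2500 * (e + 2) ^ 2 * (4 * e * 2 ^ e + 1)) fun s' =>
      TableState V N e k s' ∧ s'.reg Var.i = i + 1 ∧
      (∀ x, s.arr Var.out x ≠ 0 → s'.arr Var.out x ≠ 0) ∧
      ∀ a b, 1 ≤ a → 1 ≤ b → a + b ≤ N → integerComplexity a = i → integerComplexity b = k - i →
        s'.arr Var.out (a + b) ≠ 0 := by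
  have hV := hp.roomy
  have hV4 := hV.four_le
  have hnV := hp.two_mul_lt
  have hlt := hp.lt
  have hN := hp.one_le
  have he := hp.two_le
  have hkV : k ≤ V := hs.reg_k ▸ hs.bounded.reg_le _
  set U := 4 * e * 2 ^ e + 1 with hU
  have hnU : 2 * 2 ^ e + 1 ≤ U := by
    have h3 : 2 * 2 ^ e ≤ 4 * e * 2 ^ e := Nat.mul_le_mul (by omega) le_rfl
    omega
  refine Runs.le (b := 4 + (50 * U + (2000 * (e + 2) ^ 2 * U + (4 + (50 * U + 4)))))
    (Runs.assignNat_seq hV hs.bounded (by decide) ?_) ?_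
  swap
  · have h3 : 2500 * (e + 2) ^ 2 * U = 2000 * (e + 2) ^ 2 * U + 500 * (e + 2) ^ 2 * U := by ring
    have h4 : 500 * U ≤ 500 * (e + 2) ^ 2 * U :=
      Nat.mul_le_mul (Nat.le_mul_of_pos_right _ (by positivity)) le_rfl
    omega
  have e1 : (Expr.const 2 * .reg Var.n).evalNat s = 2 * 2 ^ e := by rw [← hs.reg_n]; rfl
  rw [e1]
  set s₁ := s.setReg Var.T (2 * 2 ^ e) with hs₁
  have hb₁ : s₁.Bounded V := hs.bounded.setReg _ hnV
  have hload : ∀ idx, loadExpr.evalNat (s₁.setReg Var.I idx) =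
      if s.arr Var.out (idx % 2 ^ e) = (if idx < 2 ^ e then i else k - i) then 1 else 0 := by
    intro idx
    have h3 : loadExpr.evalNat (s₁.setReg Var.I idx) =
      if s.arr Var.out (idx % s.reg Var.n) = (if idx < s.reg Var.n then 1 else 0) * s.reg Var.i +
        (1 - if idx < s.reg Var.n then 1 else 0) * (s.reg Var.k - s.reg Var.i) then 1 else 0 := rfl
    rw [h3, hs.reg_n, hs.reg_k, hi]
    by_cases h : idx < 2 ^ e <;> simp [h]
  have hmap := runs_mapTo_frame (s := s₁) (d := Var.work) (E := loadExpr) hV hb₁ (by decide)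
    (by decide) (by decide) fun idx _ => by
      rw [hload]
      split_ifs <;> omega
  refine Runs.seq (hmap.le (Nat.mul_le_mul (by decide) hnU)) ?_
  rintro s₂ ⟨hb₂, hF₂, hA₂⟩
  have hA₂' : ∀ idx < 2 * 2 ^ e, s₂.arr Var.work idx =
      if s.arr Var.out (idx % 2 ^ e) = (if idx < 2 ^ e then i else k - i) then 1 else 0 :=
    fun idx hidx => (hA₂ idx hidx).trans (hload idx)
  have hM₂ : s₂.reg Var.M = 2 * N + 1 := (hF₂.reg _ (by decide)).trans hs.reg_M
  have hn₂ : s₂.reg Var.n = 2 ^ e := (hF₂.reg _ (by decide)).trans hs.reg_n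
  have hT₂ : s₂.reg Var.T = 2 * 2 ^ e := hF₂.reg _ (by decide)
  set g : Polynomial (ZMod (2 * N + 1)) := Polynomial.X ^ 2 ^ e + 1 with hg
  have hroot : (AdjoinRoot.root g) ^ 2 ^ e = -1 := root_pow_eq_neg_one _ _
  have hzero : ((s₂.reg Var.M : ℕ) : AdjoinRoot g) = 0 := by
    rw [hM₂, ← map_natCast (AdjoinRoot.of g), ZMod.natCast_self, map_zero]
  refine Runs.seq (runs_convolve hV hb₂ he hp.le hn₂ hT₂ (by omega) hzero hroot) ?_
  rintro s₃ ⟨hb₃, hF₃, κ, hκ⟩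
  have hF₃' : ConvFrame s s₃ := (((Frame.refl _ _ s).setReg (by decide) _).trans
    (hF₂.mono (by decide) (by decide))).trans hF₃
  have hconv : ∀ x ≤ N, 0 < s₃.arr Var.work x % (2 * N + 1) ↔
      ∃ a b, a + b = x ∧ s.arr Var.out a = i ∧ s.arr Var.out b = k - i := by
    intro x hx
    rw [mod_pos_iff hlt rfl hN ?_ ?_ hκ hx]
    · constructor
      · rintro ⟨a, b, hab, ha, hb⟩
        rw [hA₂' a (by omega), if_pos (by omega : a < 2 ^ e), Nat.mod_eq_of_lt (by omega)] at ha
        rw [hA₂' _ (by omega), if_neg (by omega : ¬ 2 ^ e + b < 2 ^ e), Nat.add_mod_left,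
          Nat.mod_eq_of_lt (by omega)] at hb
        exact ⟨a, b, hab, by simpa using ha, by simpa using hb⟩
      · rintro ⟨a, b, hab, ha, hb⟩
        refine ⟨a, b, hab, ?_, ?_⟩
        · rw [hA₂' a (by omega), if_pos (by omega : a < 2 ^ e), Nat.mod_eq_of_lt (by omega),
            if_pos ha]
        · rw [hA₂' _ (by omega), if_neg (by omega : ¬ 2 ^ e + b < 2 ^ e), Nat.add_mod_left,
            Nat.mod_eq_of_lt (by omega), if_pos hb]
    -- Beyond N the table holds only 0, which differs from the positive numbers i and k - i, so both
    -- blocks are zero there.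
    · intro y hy1 hy2
      have hout : s.arr Var.out y = 0 := by
        by_contra hne
        have := hs.table.sound y hne
        omega
      constructor
      · rw [hA₂' y (by omega), if_pos hy2, Nat.mod_eq_of_lt hy2, if_neg (by omega)]
      · rw [hA₂' _ (by omega), if_neg (by omega : ¬ 2 ^ e + y < 2 ^ e), Nat.add_mod_left,
            Nat.mod_eq_of_lt hy2, if_neg (by omega)]
    · intro y hy
      rw [hA₂' y hy]
      split_ifs <;> omega
  have e4 : (Expr.reg Var.N + .const 1).evalNat s₃ = N + 1 := by
    rw [← hs.reg_N, ← hF₃'.reg Var.N (by decide)]; rfl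
  refine Runs.assignNat_seq hV hb₃ (by decide) ?_
  rw [e4]
  set s₄ := s₃.setReg Var.T (N + 1) with hs₄
  have hb₄ : s₄.Bounded V := hb₃.setReg _ (by omega)
  have hout₄ : s₄.arr Var.out = s.arr Var.out := hF₃'.arr _ (by decide)
  have hmerge : ∀ x, mergeExpr.evalNat (s₄.setReg Var.I x) = s.arr Var.out x +
      if s.arr Var.out x = 0 ∧ 0 < s₃.arr Var.work x % (2 * N + 1) then k else 0 := by
    intro x
    have h3 : mergeExpr.evalNat (s₄.setReg Var.I x) = s₄.arr Var.out x +
      (if s₄.arr Var.out x = 0 then 1 else 0) *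
        (if 0 < s₃.arr Var.work x % s₃.reg Var.M then 1 else 0) * s₃.reg Var.k := rfl
    rw [h3, hout₄, hF₃'.reg Var.M (by decide), hF₃'.reg Var.k (by decide), hs.reg_M, hs.reg_k]
    by_cases h4 : s.arr Var.out x = 0 <;>
      by_cases h5 : 0 < s₃.arr Var.work x % (2 * N + 1) <;> simp [h4, h5]
  have hmap₄ := runs_mapTo (s := s₄) (d := Var.out) (E := mergeExpr) hV hb₄ (by decide)
    (by decide) (by decide) fun idx _ => by
      rw [hmerge]
      have := hs.table.le idx
      split_ifs with h3
      · rw [h3.1]; omega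
      · omega
  have hT₄ : s₄.reg Var.T = N + 1 := rfl
  refine Runs.seq (hmap₄.le (Nat.mul_le_mul (by decide) (by rw [hT₄]; omega))) ?_
  rintro s₅ ⟨hb₅, hreg₅, harr₅, hout₅⟩
  have hout₅' : ∀ x, s₅.arr Var.out x = if x ≤ N then s.arr Var.out x +
      (if s.arr Var.out x = 0 ∧ 0 < s₃.arr Var.work x % (2 * N + 1) then k else 0) else
        s.arr Var.out x := by
    intro x
    rw [hout₅, hmerge, hT₄, hout₄, if_congr Nat.lt_succ_iff rfl rfl]
  have e6 : (Expr.reg Var.i + .const 1).evalNat s₅ = i + 1 := by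
    change s₅.reg Var.i + 1 = _
    rw [hreg₅ _ (by decide), ← hi, ← hF₃'.reg Var.i (by decide)]
    rfl
  refine Runs.assignNat hV hb₅ (by decide) ?_
  rw [e6]
  refine ⟨⟨hb₅.setReg _ (by omega), ?_, ?_, ?_, ?_, ?_, ?_⟩, rfl, ?_, ?_⟩
  · exact (hreg₅ _ (by decide)).trans ((hF₃'.reg Var.N (by decide)).trans hs.reg_N)
  · exact (hreg₅ _ (by decide)).trans ((hF₃'.reg Var.M (by decide)).trans hs.reg_M)
  · exact (hreg₅ _ (by decide)).trans ((hF₃'.reg Var.n (by decide)).trans hs.reg_n)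
  · exact (hreg₅ _ (by decide)).trans ((hF₃'.reg Var.e (by decide)).trans hs.reg_e)
  · exact (hreg₅ _ (by decide)).trans ((hF₃'.reg Var.k (by decide)).trans hs.reg_k)
  · refine hs.table.extend fun x => ?_
    change s₅.arr Var.out x = _ ∨ _ ∧ s₅.arr Var.out x = k ∧ _
    rw [hout₅']
    split_ifs with h3 h4
    · right
      obtain ⟨a, b, hab, ha, hb⟩ := (hconv x h3).1 h4.2
      have ha' := (hs.table.eq_iff hi1 hik a).1 ha
      have hb' := (hs.table.eq_iff (by omega) (by omega) b).1 hb
      have hle := integerComplexity_add_le ha'.1 hb'.1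
      rw [hab] at hle
      refine ⟨h4.1, by omega, by omega, h3, by omega⟩
    · left; rfl
    · left; rfl
  · intro x hx
    change s₅.arr Var.out x ≠ 0
    rw [hout₅']
    split_ifs <;> omega
  · intro a b ha hb hab hfa hfb
    change s₅.arr Var.out (a + b) ≠ 0
    rw [hout₅', if_pos hab]
    have hc := (hconv (a + b) hab).2 ⟨a, b, rfl,
      (hs.table.eq_iff hi1 hik a).2 ⟨ha, by omega, hfa⟩,
      (hs.table.eq_iff (by omega) (by omega) b).2 ⟨hb, by omega, hfb⟩⟩
    by_cases h0 : s.arr Var.out (a + b) = 0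
    · rw [if_pos ⟨h0, hc⟩]; omega
    · omega

theorem runs_addLoop (hp : Params w V N e) (hk : 2 ≤ k) (hs : TableState V N e k s) :
    Runs w addLoop s (k * (2500 * (e + 2) ^ 2 * (4 * e * 2 ^ e + 1) + 4) + 6) fun s' =>
      TableState V N e k s' ∧ ∀ a b, 1 ≤ a → 1 ≤ b → a + b ≤ N →
        integerComplexity a + integerComplexity b = k → s'.arr Var.out (a + b) ≠ 0 := by
  have hV := hp.roomy
  have hV4 := hV.four_le
  set K := 2500 * (e + 2) ^ 2 * (4 * e * 2 ^ e + 1) with hK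
  have hloop := Runs.loop (w := w) (s := s.setReg Var.i 1) (e := .op .lt (.reg Var.i) (.reg Var.k))
    (P := addStep) (fun i s' => 1 ≤ i ∧ TableState V N e k s' ∧ s'.reg Var.i = i ∧
      ∀ a b, 1 ≤ a → 1 ≤ b → a + b ≤ N → integerComplexity a < i →
        integerComplexity a + integerComplexity b = k → s'.arr Var.out (a + b) ≠ 0)
    (fun i => (k - i) * (K + 4)) ?_ 1 ?_
  · refine Runs.le (Runs.assignNat_seq hV hs.bounded (by decide) (hloop.mono le_rfl ?_)) ?_
    · rintro s' ⟨i, ⟨hi1, hs', hi, hadd⟩, h0⟩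
      rw [Expr.eval_lt_eq_zero hV hs'.bounded _ _ (by decide), evalNat_reg, evalNat_reg, hi,
        hs'.reg_k] at h0
      refine ⟨hs', fun a b ha hb hab hf => hadd a b ha hb hab ?_ hf⟩
      have := one_le_integerComplexity hb
      omega
    · have h3 : (k - 1) * (K + 4) ≤ k * (K + 4) := Nat.mul_le_mul (by omega) le_rfl
      simp only [Expr.cost]
      omega
  · rintro i s' ⟨hi1, hs', hi, hadd⟩ hne
    rw [Ne, Expr.eval_lt_eq_zero hV hs'.bounded _ _ (by decide), evalNat_reg, evalNat_reg, hi,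
        hs'.reg_k, not_le] at hne
    refine ⟨K, (runs_addStep hp hs' hi hi1 hne).mono le_rfl ?_⟩
    rintro s'' ⟨hs'', hi'', hmono, hnew⟩
    refine ⟨i + 1, ⟨by omega, hs'', hi'', fun a b ha hb hab hlt hf => ?_⟩, ?_⟩
    · rcases Nat.lt_succ_iff_lt_or_eq.1 hlt with h3 | h3
      · exact hmono _ (hadd a b ha hb hab h3 hf)
      · exact hnew a b ha hb hab h3 (by omega)
    · have h3 : k - i = (k - (i + 1)) + 1 := by omega
      have h4 : (Expr.op .lt (.reg Var.i) (.reg Var.k)).cost = 3 := rfl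
      rw [h3, h4, Nat.add_mul]
      omega
  · refine ⟨le_rfl, ⟨hs.bounded.setReg _ (by omega), hs.reg_N, hs.reg_M, hs.reg_n, hs.reg_e,
      hs.reg_k, hs.table⟩, rfl, fun a b ha _ _ hlt _ => ?_⟩
    have := one_le_integerComplexity ha
    omega

end WordRAM

namespace WordRAM

open Finset

variable {w V N e k : ℕ} {s : State}

/-! ### Products -/

theorem Params.succ_le (h : Params w V N e) : N + 1 ≤ V := by
  have h1 := h.two_mul_lt
  have h2 := h.lt
  omega

/-- The entry for the product of `a` and `b`. -/
def productExpr : Expr :=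
  let o := Expr.load Var.out (.reg Var.a * .reg Var.b)
  let x := Expr.load Var.out (.reg Var.a)
  let y := Expr.load Var.out (.reg Var.b)
  o + .op .eq o (.const 0) * .op .lt (.const 0) x * .op .lt (.const 0) y *
    .op .eq (x + y) (.reg Var.k) * .reg Var.k

def mulStep : Program :=
  .seq (.store Var.out (.reg Var.a * .reg Var.b) productExpr)
    (.assign Var.b (.reg Var.b + .const 1))

def mulInner : Program :=
  .seq (.assign Var.b (.const 1))
    (.loop (.op .lt (.reg Var.a * .reg Var.b) (.reg Var.N + .const 1)) mulStep)

def mulLoop : Program :=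
  .seq (.assign Var.a (.const 1)) (.loop (.op .lt (.reg Var.a) (.reg Var.N + .const 1))
    (.seq mulInner (.assign Var.a (.reg Var.a + .const 1))))

theorem TableState.setReg (hs : TableState V N e k s) {r v : ℕ} (hr : 5 ≤ r) (hv : v ≤ V) :
    TableState V N e k (s.setReg r v) := by
  have h : ∀ r' < 5, (s.setReg r v).reg r' = s.reg r' := fun r' hr' => by
    rw [State.reg_setReg, if_neg (by omega)]
  exact ⟨hs.bounded.setReg _ hv, (h _ (by decide)).trans hs.reg_N, (h _ (by decide)).trans hs.reg_M,
    (h _ (by decide)).trans hs.reg_n, (h _ (by decide)).trans hs.reg_e,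
    (h _ (by decide)).trans hs.reg_k, hs.table⟩

/-- Nonzero entries are true complexities, so two of them adding up to k certify a product of
complexity at most k. Conversely, two positive complexities with sum k are both below k, so their
entries are present. The table can thus be updated in place. -/
theorem runs_mulStep (hp : Params w V N e) {a b : ℕ} (hs : TableState V N e k s)
    (ha : s.reg Var.a = a) (hb : s.reg Var.b = b) (ha1 : 1 ≤ a) (hb1 : 1 ≤ b) (hab : a * b ≤ N) :
    Runs w mulStep s 40 fun s' => TableState V N e k s' ∧ s'.reg Var.a = a ∧
      s'.reg Var.b = b + 1 ∧ (∀ x, s.arr Var.out x ≠ 0 → s'.arr Var.out x ≠ 0) ∧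
      (integerComplexity a + integerComplexity b = k → s'.arr Var.out (a * b) ≠ 0) := by
  have hV := hp.roomy
  have hV4 := hV.four_le
  have hNV := hp.succ_le
  have hbN : b ≤ N := (Nat.le_mul_of_pos_left b ha1).trans hab
  have haN : a ≤ N := (Nat.le_mul_of_pos_right a hb1).trans hab
  have hkV : k ≤ V := hs.reg_k ▸ hs.bounded.reg_le _
  set o := s.arr Var.out with ho
  have ht : PartialTable N k o := hs.table
  have hval : productExpr.evalNat s = o (a * b) +
      if o (a * b) = 0 ∧ 0 < o a ∧ 0 < o b ∧ o a + o b = k then k else 0 := by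
    have h3 : productExpr.evalNat s = o (s.reg Var.a * s.reg Var.b) +
      (if o (s.reg Var.a * s.reg Var.b) = 0 then 1 else 0) * (if 0 < o (s.reg Var.a) then 1 else 0) *
        (if 0 < o (s.reg Var.b) then 1 else 0) *
        (if o (s.reg Var.a) + o (s.reg Var.b) = s.reg Var.k then 1 else 0) * s.reg Var.k := rfl
    rw [h3, ha, hb, hs.reg_k]
    by_cases h4 : o (a * b) = 0 <;> by_cases h5 : 0 < o a <;> by_cases h6 : 0 < o b <;>
      by_cases h7 : o a + o b = k <;> simp only [h4, h5, h6, h7, if_true, if_false, and_true, and_false, mul_zero, zero_mul, mul_one, one_mul]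
  set v := productExpr.evalNat s with hv
  have hvV : v ≤ V := by
    rw [hval]
    have := ht.le (a * b)
    split_ifs with h3
    · rw [h3.1]; omega
    · exact this.trans hkV
  have hidx : (Expr.reg Var.a * .reg Var.b).evalNat s = a * b := by rw [← ha, ← hb]; rfl
  have hb₁ : (s.setArr Var.out (a * b) v).Bounded V := hs.bounded.setArr _ _ hvV
  have harr : ∀ x, (s.setArr Var.out (a * b) v).arr Var.out x = if x = a * b then v else o x := by
    intro x
    rw [State.arr_setArr]
    simp [ho]
  have hstore := Runs.storeNat (a := Var.out) (i := .reg Var.a * .reg Var.b) (e := productExpr)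
    (Q := fun s' => s' = s.setArr Var.out (a * b) v) hV hs.bounded (by decide) (by decide)
    (by rw [hidx])
  refine Runs.le (Runs.seq (hstore.le (by decide)) ?_) (b := 36 + 4) (by decide)
  rintro _ rfl
  have e6 : (Expr.reg Var.b + .const 1).evalNat (s.setArr Var.out (a * b) v) = b + 1 := by
    rw [← hb]; rfl
  refine Runs.assignNat hV hb₁ (by decide) ?_
  rw [e6]
  have hs₁ : TableState V N e k (s.setArr Var.out (a * b) v) := by
    refine ⟨hb₁, hs.reg_N, hs.reg_M, hs.reg_n, hs.reg_e, hs.reg_k, ht.extend fun x => ?_⟩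
    rw [harr]
    split_ifs with h3
    · subst h3
      rw [hval]
      split_ifs with h4
      · right
        obtain ⟨h5, h6, h7, h8⟩ := h4
        have ha' := ht.sound a h6.ne'
        have hb' := ht.sound b h7.ne'
        have hle := integerComplexity_mul_le ha1 hb1
        refine ⟨h5, by omega, Nat.mul_pos ha1 hb1, hab, by omega⟩
      · left; rfl
    · left; rfl
  refine ⟨hs₁.setReg (by decide) (by omega), ha, rfl, ?_, ?_⟩
  · intro x hx
    change (s.setArr Var.out (a * b) v).arr Var.out x ≠ 0
    rw [harr]
    split_ifs with h3
    · subst h3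
      rw [hval]
      omega
    · exact hx
  · intro hf
    change (s.setArr Var.out (a * b) v).arr Var.out (a * b) ≠ 0
    rw [harr, if_pos rfl, hval]
    have h1 := one_le_integerComplexity ha1
    have h2 := one_le_integerComplexity hb1
    have h3 := ht.complete a ha1 haN (by omega)
    have h4 := ht.complete b hb1 hbN (by omega)
    by_cases h0 : o (a * b) = 0
    · rw [if_pos ⟨h0, by omega, by omega, by omega⟩]
      omega
    · omega

theorem runs_mulInner (hp : Params w V N e) {a : ℕ} (hs : TableState V N e k s)
    (ha : s.reg Var.a = a) (ha1 : 1 ≤ a) :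
    Runs w mulInner s (50 * (N / a) + 20) fun s' => TableState V N e k s' ∧ s'.reg Var.a = a ∧
      (∀ x, s.arr Var.out x ≠ 0 → s'.arr Var.out x ≠ 0) ∧
      ∀ b, 1 ≤ b → a * b ≤ N → integerComplexity a + integerComplexity b = k →
        s'.arr Var.out (a * b) ≠ 0 := by
  have hV := hp.roomy
  have hV4 := hV.four_le
  have hcond : ∀ (s' : State) (b : ℕ), TableState V N e k s' → s'.reg Var.a = a →
      s'.reg Var.b = b →
      ((Expr.op .lt (.reg Var.a * .reg Var.b) (.reg Var.N + .const 1)).eval w s' = 0 ↔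
        N + 1 ≤ a * b) := by
    intro s' b h h1 h2
    rw [Expr.eval_lt_eq_zero hV h.bounded _ _ (by decide), ← h1, ← h2, ← h.reg_N]
    rfl
  have hloop := Runs.loop (w := w) (s := s.setReg Var.b 1)
    (e := .op .lt (.reg Var.a * .reg Var.b) (.reg Var.N + .const 1)) (P := mulStep)
    (fun b s' => 1 ≤ b ∧ TableState V N e k s' ∧ s'.reg Var.a = a ∧ s'.reg Var.b = b ∧
      (∀ x, s.arr Var.out x ≠ 0 → s'.arr Var.out x ≠ 0) ∧
      ∀ b', 1 ≤ b' → b' < b → a * b' ≤ N → integerComplexity a + integerComplexity b' = k →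
        s'.arr Var.out (a * b') ≠ 0)
    (fun b => 50 * (N / a + 1 - b)) ?_ 1 ?_
  · refine Runs.le (Runs.assignNat_seq hV hs.bounded (by decide) (hloop.mono le_rfl ?_)) ?_
    · rintro s' ⟨b, ⟨hb1, hs', ha', hb, hmono, hdone⟩, h0⟩
      rw [hcond s' b hs' ha' hb] at h0
      refine ⟨hs', ha', hmono, fun b' hb' hab' hf => hdone b' hb' ?_ hab' hf⟩
      exact Nat.lt_of_mul_lt_mul_left (by omega : a * b' < a * b)
    · have h4 : (Expr.op .lt (.reg Var.a * .reg Var.b) (.reg Var.N + .const 1)).cost = 7 := rfl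
      have h5 : (Expr.const 1).cost = 1 := rfl
      rw [h4, h5]
      omega
  · rintro b s' ⟨hb1, hs', ha', hb, hmono, hdone⟩ hne
    rw [Ne, hcond s' b hs' ha' hb, not_le, Nat.lt_succ_iff] at hne
    refine ⟨40, (runs_mulStep hp hs' ha' hb ha1 hb1 hne).mono le_rfl ?_⟩
    rintro s'' ⟨hs'', ha'', hb'', hmono', hnew⟩
    refine ⟨b + 1, ⟨by omega, hs'', ha'', hb'', fun x hx => hmono' x (hmono x hx),
      fun b' h1 h2 h3 h4 => ?_⟩, ?_⟩
    · rcases Nat.lt_succ_iff_lt_or_eq.1 h2 with h5 | rfl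
      · exact hmono' _ (hdone b' h1 h5 h3 h4)
      · exact hnew h4
    · have h4 : (Expr.op .lt (.reg Var.a * .reg Var.b) (.reg Var.N + .const 1)).cost = 7 := rfl
      have h5 : b ≤ N / a := (Nat.le_div_iff_mul_le ha1).2 (by rwa [mul_comm])
      rw [h4]
      omega
  · exact ⟨le_rfl, hs.setReg (by decide) (by omega), ha, rfl, fun _ h => h,
      fun b' h1 h2 => by omega⟩

/-- Dyadic bound for the harmonic sum: the 2^j terms with 2^j ≤ a < 2^(j+1) are each at most N /
2^j. -/
theorem sum_div_le (e N : ℕ) : ∑ a ∈ Ico 1 (2 ^ e), N / a ≤ e * N := by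
  induction e with
  | zero => simp
  | succ e ih =>
    rw [← sum_Ico_consecutive _ (Nat.one_le_two_pow (n := e))
      (Nat.pow_le_pow_right (by norm_num) (Nat.le_succ e)), Nat.add_mul, one_mul]
    refine Nat.add_le_add ih ?_
    have h1 : ∑ a ∈ Ico (2 ^ e) (2 ^ (e + 1)), N / a ≤
        (Ico (2 ^ e) (2 ^ (e + 1))).card • (N / 2 ^ e) :=
      sum_le_card_nsmul _ _ _ fun a ha =>
        Nat.div_le_div_left (mem_Ico.1 ha).1 (by positivity)
    refine h1.trans ?_
    rw [Nat.card_Ico, smul_eq_mul, pow_succ, mul_two, Nat.add_sub_cancel]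
    exact Nat.mul_div_le N (2 ^ e)

theorem runs_mulLoop (hp : Params w V N e) (hs : TableState V N e k s) :
    Runs w mulLoop s (90 * e * N + 20) fun s' =>
      TableState V N e k s' ∧ (∀ x, s.arr Var.out x ≠ 0 → s'.arr Var.out x ≠ 0) ∧
      ∀ a b, 1 ≤ a → 1 ≤ b → a * b ≤ N → integerComplexity a + integerComplexity b = k →
        s'.arr Var.out (a * b) ≠ 0 := by
  have hV := hp.roomy
  have hV4 := hV.four_le
  have hNV := hp.succ_le
  have hN := hp.one_le
  have hcond : ∀ (s' : State) (a : ℕ), TableState V N e k s' → s'.reg Var.a = a →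
      ((Expr.op .lt (.reg Var.a) (.reg Var.N + .const 1)).eval w s' = 0 ↔ N + 1 ≤ a) := by
    intro s' a h h1
    rw [Expr.eval_lt_eq_zero hV h.bounded _ _ (by decide), ← h1, ← h.reg_N]
    rfl
  have hloop := Runs.loop (w := w) (s := s.setReg Var.a 1)
    (e := .op .lt (.reg Var.a) (.reg Var.N + .const 1))
    (P := .seq mulInner (.assign Var.a (.reg Var.a + .const 1)))
    (fun a s' => 1 ≤ a ∧ TableState V N e k s' ∧ s'.reg Var.a = a ∧
      (∀ x, s.arr Var.out x ≠ 0 → s'.arr Var.out x ≠ 0) ∧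
      ∀ a' b, 1 ≤ a' → a' < a → 1 ≤ b → a' * b ≤ N →
        integerComplexity a' + integerComplexity b = k → s'.arr Var.out (a' * b) ≠ 0)
    (fun a => ∑ a' ∈ Ico a (N + 1), (50 * (N / a') + 30)) ?_ 1 ?_
  · refine Runs.le (Runs.assignNat_seq hV hs.bounded (by decide) (hloop.mono le_rfl ?_)) ?_
    · rintro s' ⟨a, ⟨ha1, hs', ha, hmono, hdone⟩, h0⟩
      rw [hcond s' a hs' ha] at h0
      refine ⟨hs', hmono, fun a' b ha' hb hab hf => hdone a' b ha' ?_ hb hab hf⟩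
      have := Nat.le_mul_of_pos_right a' hb
      omega
    · have h4 : (Expr.op .lt (.reg Var.a) (.reg Var.N + .const 1)).cost = 5 := rfl
      have h5 : (Expr.const 1).cost = 1 := rfl
      have h6 : ∑ a ∈ Ico 1 (N + 1), N / a ≤ e * N := by
        refine le_trans (sum_le_sum_of_subset ?_) (sum_div_le e N)
        refine Ico_subset_Ico le_rfl ?_
        have := hp.lt
        omega
      have h7 : 1 * N ≤ e * N := Nat.mul_le_mul (by have := hp.two_le; omega) le_rfl
      have h8 : 90 * e * N = 90 * (e * N) := by ring
      rw [h4, h5, h8, sum_add_distrib, ← mul_sum, sum_const, Nat.card_Ico, smul_eq_mul]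
      omega
  · rintro a s' ⟨ha1, hs', ha, hmono, hdone⟩ hne
    rw [Ne, hcond s' a hs' ha, not_le] at hne
    refine ⟨50 * (N / a) + 20 + 4, Runs.seq (runs_mulInner hp hs' ha ha1) ?_⟩
    rintro s₁ ⟨hs₁, ha₁, hmono₁, hdone₁⟩
    refine Runs.assignNat hV hs₁.bounded (by decide) ?_
    have e6 : (Expr.reg Var.a + .const 1).evalNat s₁ = a + 1 := by rw [← ha₁]; rfl
    rw [e6]
    refine ⟨a + 1, ⟨by omega, hs₁.setReg (by decide) (by omega), rfl,
      fun x hx => hmono₁ x (hmono x hx), fun a' b h1 h2 h3 h4 h5 => ?_⟩, ?_⟩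
    · rcases Nat.lt_succ_iff_lt_or_eq.1 h2 with h6 | rfl
      · exact hmono₁ _ (hdone a' b h1 h6 h3 h4 h5)
      · exact hdone₁ b h3 h4 h5
    · have h4 : (Expr.op .lt (.reg Var.a) (.reg Var.N + .const 1)).cost = 5 := rfl
      rw [h4, sum_eq_sum_Ico_succ_bot hne]
  · exact ⟨le_rfl, hs.setReg (by decide) (by omega), rfl, fun _ h => h,
      fun a' b h1 h2 => by omega⟩

/-! ### The algorithm -/

def roundStep : Program :=
  .seq addLoop (.seq mulLoop (.assign Var.k (.reg Var.k + .const 1)))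

def rounds : Program :=
  .loop (.op .lt (.reg Var.k) (.const 3 * .reg Var.e)) roundStep

/-- Compute the modulus and the block length. -/
def setup : Program :=
  .seq (.assign Var.M (.const 2 * .reg Var.N + .const 1)) (.seq (.assign Var.n (.const 4))
    (.seq (.assign Var.e (.const 2)) (.loop (.op .lt (.reg Var.n) (.reg Var.M))
      (.seq (.assign Var.n (.const 2 * .reg Var.n)) (.assign Var.e (.reg Var.e + .const 1))))))

/-- The computation of all integer complexities up to `N`. -/
def complexityProgram : Program :=
  .seq setup (.seq (.store Var.out (.const 1) (.const 1)) (.seq (.assign Var.k (.const 2)) rounds))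

/-- As N < 2^(e-1), all relevant complexities are at most 3(e - 2) + 1 < 3e, so a table complete
below 3e is the full answer. -/
theorem runs_rounds (hp : Params w V N e) (heV : 3 * e ≤ V) (hs : TableState V N e 2 s) :
    Runs w rounds s (3 * e * (10000 * e * (e + 2) ^ 2 * (4 * e * 2 ^ e + 1)) + 6) fun s' =>
      ∀ x, 1 ≤ x → x ≤ N → s'.arr Var.out x = integerComplexity x := by
  have hV := hp.roomy
  have hlt := hp.lt
  have he := hp.two_le
  set U := 4 * e * 2 ^ e + 1 with hU
  have hcond : ∀ (s' : State) (k : ℕ), TableState V N e k s' →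
      ((Expr.op .lt (.reg Var.k) (.const 3 * .reg Var.e)).eval w s' = 0 ↔ 3 * e ≤ k) := by
    intro s' k h
    rw [Expr.eval_lt_eq_zero hV h.bounded _ _ (by decide), evalNat_mul, evalNat_const, evalNat_reg,
      evalNat_reg, h.reg_k, h.reg_e]
  refine Runs.mono (Runs.loop (fun k s' => 2 ≤ k ∧ TableState V N e k s')
    (fun k => (3 * e - k) * (10000 * e * (e + 2) ^ 2 * U)) ?_ 2 ⟨le_rfl, hs⟩) ?_ ?_
  · rintro k s' ⟨hk, hs'⟩ hne
    rw [Ne, hcond s' k hs', not_le] at hne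
    refine ⟨_, Runs.seq (runs_addLoop hp hk hs') (b' := 90 * e * N + 20 + 4) fun s₁ h₁ =>
      Runs.seq (runs_mulLoop hp h₁.1) fun s₂ h₂ => Runs.assignNat hV h₂.1.bounded (by decide) ?_⟩
    obtain ⟨hs₁, hadd⟩ := h₁
    obtain ⟨hs₂, hmono, hmul⟩ := h₂
    have e6 : (Expr.reg Var.k + .const 1).evalNat s₂ = k + 1 := by rw [← hs₂.reg_k]; rfl
    rw [e6]
    refine ⟨k + 1, ⟨by omega, hs₂.bounded.setReg _ (by omega), hs₂.reg_N, hs₂.reg_M, hs₂.reg_n,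
      hs₂.reg_e, rfl, hs₂.table.succ hk (fun a b ha hb hab hf => hmono _ (hadd a b ha hb hab hf))
        hmul⟩, ?_⟩
    have h4 : (Expr.op .lt (.reg Var.k) (.const 3 * .reg Var.e)).cost = 5 := rfl
    have h5 : 3 * e - k = (3 * e - (k + 1)) + 1 := by omega
    rw [h4, h5, Nat.add_mul (3 * e - (k + 1)) 1, one_mul, ← hU]
    set Y := e * ((e + 2) ^ 2 * U) with hY
    have h6 : 10000 * e * (e + 2) ^ 2 * U = 10000 * Y := by rw [hY]; ring
    have h7 : k * (2500 * (e + 2) ^ 2 * U + 4) ≤ 7500 * Y + 12 * e := by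
      calc k * (2500 * (e + 2) ^ 2 * U + 4) ≤ 3 * e * (2500 * (e + 2) ^ 2 * U + 4) :=
            Nat.mul_le_mul hne.le le_rfl
        _ = 7500 * Y + 12 * e := by rw [hY]; ring
    have hpos : 1 ≤ (e + 2) ^ 2 := Nat.one_le_pow _ _ (by omega)
    have hU16 : 8 * N + 16 ≤ 16 * U := by
      have : 4 * 2 ^ e ≤ 4 * e * 2 ^ e := Nat.mul_le_mul (by omega) le_rfl
      omega
    have h8 : e * U ≤ Y := Nat.mul_le_mul le_rfl (Nat.le_mul_of_pos_left U hpos)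
    have h9 : e * (8 * N + 16) ≤ e * (16 * U) := Nat.mul_le_mul le_rfl hU16
    have h10 : e * (8 * N + 16) = 8 * (e * N) + 16 * e := by ring
    have h11 : e * (16 * U) = 16 * (e * U) := by ring
    have h12 : 90 * e * N = 90 * (e * N) := by ring
    rw [h6, h12]
    omega
  · have h4 : (Expr.op .lt (.reg Var.k) (.const 3 * .reg Var.e)).cost = 5 := rfl
    rw [h4]
    change (3 * e - 2) * (10000 * e * (e + 2) ^ 2 * U) + 6 ≤ _
    exact Nat.add_le_add_right (Nat.mul_le_mul (Nat.sub_le _ _) le_rfl) _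
  · rintro s' ⟨k, ⟨hk, hs'⟩, h0⟩ x hx1 hx2
    rw [hcond s' k hs'] at h0
    refine hs'.table.complete x hx1 hx2 ?_
    have h5 : 2 * x < 2 * 2 ^ (e - 2 + 1) := by
      rw [← pow_succ', show e - 2 + 1 + 1 = e by omega]
      omega
    have := integerComplexity_le_of_lt_two_pow (e - 2) x hx1 (by omega)
    omega

theorem runs_setup (hV : Roomy w V) (hs : (initState N).Bounded V) (he : 2 ≤ e)
    (hlt : 2 * N < 2 ^ e) (hmin : 2 ^ (e - 1) ≤ 2 * N) (hVe : 4 * e * 2 ^ e ≤ V) :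
    Runs w setup (initState N) (20 * e + 20) fun s' => s'.Bounded V ∧ s'.reg Var.N = N ∧
      s'.reg Var.M = 2 * N + 1 ∧ s'.reg Var.n = 2 ^ e ∧ s'.reg Var.e = e ∧
      s'.arr = fun _ _ => 0 := by
  have hV4 := hV.four_le
  have heV : e + 2 * 2 ^ e ≤ V := by
    have h1 : e ≤ e * 2 ^ e := Nat.le_mul_of_pos_right _ (by positivity)
    have h2 : 2 * 2 ^ e ≤ e * 2 ^ e := Nat.mul_le_mul he le_rfl
    have h3 : 4 * e * 2 ^ e = 4 * (e * 2 ^ e) := by ring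
    omega
  have hb₁ : ((initState N).setReg Var.M (2 * N + 1)).Bounded V := hs.setReg _ (by omega)
  have hb₂ := hb₁.setReg Var.n hV4
  have hb₃ := hb₂.setReg Var.e (by omega : 2 ≤ V)
  refine Runs.le (Runs.assignNat_seq hV hs (by decide) (Runs.assignNat_seq hV hb₁ (by decide)
    (Runs.assignNat_seq hV hb₂ (by decide) ((Runs.loop (fun d s' => 2 ≤ d ∧ d ≤ e ∧ s'.Bounded V ∧
      s'.reg Var.N = N ∧ s'.reg Var.M = 2 * N + 1 ∧ s'.reg Var.n = 2 ^ d ∧ s'.reg Var.e = d ∧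
      s'.arr = fun _ _ => 0) (fun d => 12 * (e - d)) ?_ 2
      ⟨le_rfl, he, hb₃, rfl, rfl, rfl, rfl, rfl⟩).mono le_rfl ?_)))) ?_
  · rintro d s' ⟨hd, hde, hb, hN, hM, hn, hd', harr⟩ hne
    rw [Ne, Expr.eval_lt_eq_zero hV hb _ _ (by decide), evalNat_reg, evalNat_reg, hM, hn] at hne
    have hlt' : d < e := by
      by_contra h
      obtain rfl : d = e := by omega
      omega
    have h2d : 2 ^ (d + 1) ≤ 2 ^ e := Nat.pow_le_pow_right (by norm_num) hlt'
    have e1 : (Expr.const 2 * .reg Var.n).evalNat s' = 2 ^ (d + 1) := by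
      rw [pow_succ', ← hn]; rfl
    have hb' := hb.setReg Var.n (by omega : 2 ^ (d + 1) ≤ V)
    refine ⟨4 + 4, Runs.assignNat_seq hV hb (by decide) ?_⟩
    rw [e1]
    refine Runs.assignNat hV hb' (by decide) ?_
    have e2 : (Expr.reg Var.e + .const 1).evalNat (s'.setReg Var.n (2 ^ (d + 1))) = d + 1 := by
      change s'.reg Var.e + 1 = _
      rw [hd']
    rw [e2]
    refine ⟨d + 1, ⟨by omega, hlt', hb'.setReg _ (by omega), hN, hM, rfl, rfl, harr⟩, ?_⟩
    simp only [Expr.cost]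
    omega
  · rintro s' ⟨d, ⟨hd, hde, hb, hN, hM, hn, hd', harr⟩, h0⟩
    rw [Expr.eval_lt_eq_zero hV hb _ _ (by decide), evalNat_reg, evalNat_reg, hM, hn] at h0
    -- The minimality of e enters here: for d < e one has 2^d ≤ 2N < M, and the loop would have
    -- continued.
    have hde' : d = e := by
      by_contra h
      have : 2 ^ d ≤ 2 ^ (e - 1) := Nat.pow_le_pow_right (by norm_num) (by omega)
      omega
    subst hde'
    exact ⟨hb, hN, hM, hn, hd', harr⟩
  · have h4 : (Expr.const 2 * .reg Var.N + .const 1).cost = 5 := rfl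
    simp only [Expr.cost]
    omega

theorem runs_complexityProgram (hp : Params w V N e) (hmin : 2 ^ (e - 1) ≤ 2 * N) :
    Runs w complexityProgram (initState N)
      (31000 * e ^ 2 * (e + 2) ^ 2 * (4 * e * 2 ^ e + 1)) fun s' =>
      ∀ x, 1 ≤ x → x ≤ N → s'.arr Var.out x = integerComplexity x := by
  have hV := hp.roomy
  have hV4 := hV.four_le
  have he := hp.two_le
  have hNV := hp.succ_le
  have hs : (initState N).Bounded V := by
    refine ⟨fun r => ?_, fun _ _ => Nat.zero_le _⟩
    simp only [initState]
    split_ifs <;> omega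
  have heV : 3 * e ≤ V := by
    have h3 : 3 * e ≤ 4 * e * 2 ^ e :=
      (by omega : 3 * e ≤ 4 * e).trans (Nat.le_mul_of_pos_right _ (by positivity))
    exact h3.trans hp.le
  refine Runs.le (Runs.seq (runs_setup hV hs he hp.lt hmin hp.le) (b' := 3 + (2 +
    (3 * e * (10000 * e * (e + 2) ^ 2 * (4 * e * 2 ^ e + 1)) + 6))) fun s₁ h₁ => ?_) ?_
  · obtain ⟨hb, hN, hM, hn, he', harr⟩ := h₁
    have hb₂ : (s₁.setArr Var.out 1 1).Bounded V := hb.setArr _ _ (by omega)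
    refine Runs.seq (Q := fun s' => s' = s₁.setArr Var.out 1 1)
      (Runs.storeNat hV hb (by decide) (by decide) rfl) ?_
    rintro _ rfl
    refine Runs.assignNat_seq hV hb₂ (by decide) (runs_rounds hp heV ?_)
    refine ⟨hb₂.setReg _ (by change 2 ≤ V; omega), hN, hM, hn, he', rfl, ?_⟩
    have h3 : ((s₁.setArr Var.out 1 1).setReg Var.k ((Expr.const 2).evalNat
        (s₁.setArr Var.out 1 1))).arr Var.out = Function.update (fun _ => 0) 1 1 := by
      funext x
      rw [State.arr_setReg, State.arr_setArr, harr]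
      simp [Function.update_apply]
    rw [h3]
    exact PartialTable.start hp.one_le
  · set U := 4 * e * 2 ^ e + 1 with hU
    have h3 : 3 * e * (10000 * e * (e + 2) ^ 2 * U) = 30000 * (e ^ 2 * ((e + 2) ^ 2 * U)) := by ring
    have h4 : 31000 * e ^ 2 * (e + 2) ^ 2 * U = 31000 * (e ^ 2 * ((e + 2) ^ 2 * U)) := by ring
    have h5 : e ≤ e ^ 2 := Nat.le_self_pow (by norm_num) e
    have h6 : e ^ 2 ≤ e ^ 2 * ((e + 2) ^ 2 * U) := Nat.le_mul_of_pos_right _ (by positivity)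
    omega

end WordRAM

/-- There is a single word RAM program which, for every `N ≥ 1` and on every machine whose word
length is at least a fixed constant times the bit length of `N`, halts on input `N` after
`O(N polylog N)` steps with the integer complexity of `n` in cell `n` of array `0`, for all
`1 ≤ n ≤ N`. -/
theorem mainTheorem2 :
    ∃ (P : WordRAM.Program) (c C k : ℕ), 0 < c ∧
      ∀ N : ℕ, 1 ≤ N → ∀ w : ℕ, c * Nat.size N ≤ w →
        ∃ (s : WordRAM.State) (t : ℕ),
          WordRAM.Exec w P (WordRAM.initState N) s t ∧
          t ≤ C * N * (Nat.log 2 N + 1) ^ k ∧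
          ∀ n : ℕ, 1 ≤ n → n ≤ N → s.arr 0 n = integerComplexity n := by
  -- With L = log₂ N + 1 (rounded down) and e = L + 1, the bounds e ≤ 2L, e + 2 ≤ 4L and 4e · 2^e +
  -- 1 ≤ 34NL give the factors 4, 16 and 34 and the exponent 2 + 2 + 1 = 5.
  refine ⟨WordRAM.complexityProgram, 61, 31000 * 4 * 16 * 34, 5, by norm_num, fun N hN w hw => ?_⟩
  obtain ⟨e, he⟩ : ∃ e, e = Nat.log 2 N + 2 := ⟨_, rfl⟩
  set L := Nat.log 2 N + 1 with hL
  have hlog1 : 2 ^ Nat.log 2 N ≤ N := Nat.pow_log_le_self 2 (by omega)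
  have hlog2 : N < 2 ^ (Nat.log 2 N + 1) := Nat.lt_pow_succ_log_self (by norm_num) N
  have h2e : 2 ^ e = 4 * 2 ^ Nat.log 2 N := by rw [he, pow_add]; ring
  have hmin : 2 ^ (e - 1) ≤ 2 * N := by
    rw [he, show Nat.log 2 N + 2 - 1 = Nat.log 2 N + 1 by omega, pow_succ]
    omega
  have hlt : 2 * N < 2 ^ e := by
    rw [pow_succ] at hlog2
    omega
  have hee : e < 2 ^ e := Nat.lt_two_pow_self
  have hlogsize : Nat.log 2 N < Nat.size N := Nat.lt_size.2 hlog1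
  -- V = 2^(3e) exceeds 4e · 2^e, since 4 and e are at most 2^e. Its tenth power is 2^(30e), and
  -- 30(L + 1) < 61L because L ≥ 1, which accounts for the constant 61.
  have hp : WordRAM.Params w (2 ^ (3 * e)) N e := by
    refine ⟨⟨?_, ?_⟩, hN, by omega, hlt, ?_⟩
    · calc 4 = 2 ^ 2 := by norm_num
        _ ≤ 2 ^ (3 * e) := Nat.pow_le_pow_right (by norm_num) (by omega)
    · rw [← pow_mul]
      exact Nat.pow_lt_pow_right (by norm_num) (by omega)
    · rw [show 2 ^ (3 * e) = 2 ^ e * 2 ^ e * 2 ^ e by ring]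
      exact Nat.mul_le_mul (Nat.mul_le_mul (by omega) hee.le) le_rfl
  obtain ⟨s, t, h1, h2, h3⟩ := WordRAM.runs_complexityProgram hp hmin
  refine ⟨s, t, h1, h2.trans ?_, h3⟩
  have hU : 4 * e * 2 ^ e + 1 ≤ 34 * N * L := by
    have h4 : e * 2 ^ e ≤ (2 * L) * (4 * N) := Nat.mul_le_mul (by omega) (by omega)
    have h5 : 1 ≤ N * L := Nat.mul_pos hN (by omega)
    have h6 : 4 * e * 2 ^ e = 4 * (e * 2 ^ e) := by ring
    have h7 : (2 * L) * (4 * N) = 8 * (N * L) := by ring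
    have h8 : 34 * N * L = 34 * (N * L) := by ring
    omega
  calc 31000 * e ^ 2 * (e + 2) ^ 2 * (4 * e * 2 ^ e + 1)
      ≤ 31000 * (2 * L) ^ 2 * (4 * L) ^ 2 * (34 * N * L) := by
        gcongr <;> omega
    _ = 31000 * 4 * 16 * 34 * N * L ^ 5 := by ring
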